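/- Let $\mathbb{G}$ be a Carnot group: a simply connected Lie group whose (finite-dimensional real) Lie algebra has a decomposition $\mathfrak g=V_1\oplus\cdots\oplus V_s$ with $V_{i}=[V_1,V_{i-1}]$ for $2\le i\le s$ and $[V_1,V_s]=0$. Fix a basis $X_1,\dots,X_n$ of $\mathfrak g$ adapted to this decomposition and identify $\mathbb G$ with $\mathbb R^n$ through exponential coordinates of the first kind, $x=\exp(x_1X_1+\dots+x_nX_n)$, the group law being given by the Baker–Campbell–Hausdorff formula; the dilation $\delta_\lambda$ $(\lambda>0)$ multiplies $x_j$ by $\lambda^i$ if $X_j\in V_i$. Let $X_1,\dots,X_r$ be the basis vectors in $V_1$, and let $\omega$ be the inner product norm on $V_1$ for which they are orthonormal. An absolutely continuous curve $\gamma\colon[a,b]\to\mathbb G$ is horizontal if $\gamma'(t)=\sum_{j\le r}u_j(t)X_j(\gamma(t))$ for almost every $t$ with $u_j\in L^1[a,b]$, where the $X_j$ are regarded as left invariant vector fields; its length is $\int_a^b|u|$. The CC distance $d(x,y)$ is the infimum of the lengths of the horizontal curves joining $x$ to $y$, and $d(x)=d(x,0)$. A function $f\colon\mathbb G\to\mathbb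 R$ is Lipschitz if it is Lipschitz with respect to $d$, with least Lipschitz constant $\mathrm{Lip}_{\mathbb G}(f)$; for $x\in\mathbb G$ and $E\in V_1$, $Ef(x)=\lim_{t\to0}\frac{f(x\exp(tE))-f(x)}{t}$ if this limit exists. A function $f\colon\mathbb G\to\mathbb R$ is Pansu differentiable at $x$ if there is $L\colon\mathbb G\to\mathbb R$ with $L(yz)=L(y)+L(z)$ and $L(\delta_\lambda(y))=\lambda L(y)$ for all $y,z\in\mathbb G$, $\lambda>0$, such that $\lim_{y\to x}\frac{|f(y)-f(x)-L(x^{-1}y)|}{d(x,y)}=0$. The CC distance is differentiable in horizontal directions if the function $y\mapsto d(y)$ is Pansu differentiable at $\exp E$ for every $E\in V_1\setminus\{0\}$. **Proposition 1.3.** The CC distance in $\mathbb G$ is differentiable in horizontal directions if and only if the following implication holds: whenever $f\colon\mathbb G\to\mathbb R$ is Lipschitz and $x\in\mathbb G$, $E\in V_1$ are such that $\omega(E)=1$, $Ef(x)$ exists and $Ef(x)=\mathrm{Lip}_{\mathbb G}(f)$, then $f$ is Pansu differentiable at $x$. -/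

import Mathlib

open Filter Topology MeasureTheory
open scoped ENNReal Nat

/-- A Carnot group written in exponential coordinates of the first kind.
The data are a stratification `𝔤 = V₁ ⊕ ⋯ ⊕ V_s` of the (real) Lie algebra `𝔤`, with
`V_{i+1} = [V₁, V_i]` and `[V₁, V_s] = 0`, together with a basis of `𝔤` adapted to it.
The underlying set of the group is `ℝⁿ`, the point `x` standing for `exp (∑ j, x j • X_j)`; the
group law is the one given by the Baker-Campbell-Hausdorff formula (`CarnotGroup.mul`).
The basis vectors of degree one form a basis of `V₁`; the inner product on `V₁` is the one for which
they are orthonormal. -/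
structure CarnotGroup (𝔤 : Type*) [LieRing 𝔤] [LieAlgebra ℝ 𝔤] (n : ℕ) where
  /-- the step `s` -/
  step : ℕ
  /-- the layers `V_i`, where `V_i = 0` unless `1 ≤ i ≤ s` -/
  layer : ℕ → Submodule ℝ 𝔤
  layer_zero : layer 0 = ⊥
  layer_eq_bot : ∀ i, step < i → layer i = ⊥
  isInternal : DirectSum.IsInternal layer
  layer_succ : ∀ i, 1 ≤ i →
    layer (i + 1) = Submodule.span ℝ {z | ∃ a ∈ layer 1, ∃ b ∈ layer i, ⁅a, b⁆ = z}
  /-- the adapted basis `X_1, …, X_n` -/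
  basis : Module.Basis (Fin n) ℝ 𝔤
  /-- the index of the layer that contains `X_j` -/
  deg : Fin n → ℕ
  basis_mem : ∀ j, basis j ∈ layer (deg j)

namespace CarnotGroup

noncomputable section

variable {𝔤 : Type*} [LieRing 𝔤] [LieAlgebra ℝ 𝔤] {n : ℕ} (G : CarnotGroup 𝔤 n)

/-- The exponential map `𝔤 → G`; in exponential coordinates it is the coordinate map. -/
def exp (E : 𝔤) : Fin n → ℝ := G.basis.equivFun E

/-- The inverse of the exponential map. -/
def log (x : Fin n → ℝ) : 𝔤 := G.basis.equivFun.symm x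

/-- `e^{ad X}`, a finite sum because `(ad X)^s = 0`. -/
def expAd (X : 𝔤) : Module.End ℝ 𝔤 :=
  ∑ k ∈ Finset.range (G.step + 1), ((k ! : ℝ)⁻¹) • (LieAlgebra.ad ℝ 𝔤 X) ^ k

/-- `g(A) = A log A / (A - 1) = ∑ m, (-1)^m / (m + 1) (A - 1)^m A` for a unipotent operator `A`
with `(A - 1)^s = 0`. -/
def bchKernel (A : Module.End ℝ 𝔤) : Module.End ℝ 𝔤 :=
  ∑ m ∈ Finset.range G.step, ((-1 : ℝ) ^ m / ((m : ℝ) + 1)) • ((A - 1) ^ m * A)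

/-- The group law, by the Baker-Campbell-Hausdorff formula (in integral form)
`log (e^X e^Y) = X + ∫₀¹ g(e^{ad X} e^{t ad Y}) Y dt`, `g(z) = z log z / (z - 1)`. -/
def mul (x y : Fin n → ℝ) : Fin n → ℝ :=
  x + ∫ t in (0 : ℝ)..1,
    G.exp (G.bchKernel (G.expAd (G.log x) * G.expAd (t • G.log y)) (G.log y))

/-- The dilation `δ_r`, which multiplies the coordinates of the `i`-th layer by `r ^ i`. -/
def dilation (r : ℝ) (x : Fin n → ℝ) : Fin n → ℝ := fun j => r ^ G.deg j * x j

/-- The value at `x` of the left invariant vector field `E`: the velocity at `t = 0` of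
`t ↦ x exp (tE)`. -/
def leftInvField (E : 𝔤) (x : Fin n → ℝ) : Fin n → ℝ :=
  deriv (fun t : ℝ => G.mul x (G.exp (t • E))) 0

/-- The indices of the basis `X_j` of the horizontal layer `V₁`. -/
abbrev HorIdx : Type := {j : Fin n // G.deg j = 1}

/-- The norm `ω` on `V₁` for which the basis `X_j` of `V₁` is orthonormal. -/
def omega (E : 𝔤) : ℝ := √(∑ j : G.HorIdx, (G.basis.repr E j) ^ 2)

/-- `γ : [a, b] → G` is a horizontal curve with controls `u_j`: it is absolutely continuous, the
`u_j` are integrable, and `γ' = ∑ j, u_j X_j(γ)` almost everywhere on `[a, b]`. -/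
structure IsHorizontalCurve (γ : ℝ → Fin n → ℝ) (u : G.HorIdx → ℝ → ℝ) (a b : ℝ) : Prop where
  le : a ≤ b
  absolutelyContinuous : AbsolutelyContinuousOnInterval γ a b
  integrable : ∀ j, IntervalIntegrable (u j) volume a b
  hasDerivAt : ∀ᵐ t ∂(volume.restrict (Set.Icc a b)),
    HasDerivAt γ (∑ j : G.HorIdx, u j t • G.leftInvField (G.basis j) (γ t)) t

/-- The length `∫_a^b |u|`. -/
def length (u : G.HorIdx → ℝ → ℝ) (a b : ℝ) : ℝ :=
  ∫ t in a..b, √(∑ j : G.HorIdx, (u j t) ^ 2)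

/-- The Carnot-Carathéodory distance `d(x, y)`: the infimum of the lengths of the horizontal curves
from `x` to `y`. It is written as an extended number, so that an infimum over no curves would be
`∞`; by Chow's theorem that does not occur. -/
def dist (x y : Fin n → ℝ) : ℝ≥0∞ :=
  sInf {ℓ | ∃ (a b : ℝ) (γ : ℝ → Fin n → ℝ) (u : G.HorIdx → ℝ → ℝ),
    G.IsHorizontalCurve γ u a b ∧ γ a = x ∧ γ b = y ∧ ℓ = ENNReal.ofReal (G.length u a b)}

/-- `d(x) = d(x, 0)`, as a real function. -/
def distZero (x : Fin n → ℝ) : ℝ := (G.dist x 0).toReal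

/-- `C` is a Lipschitz constant of `f : G → ℝ` with respect to the CC distance. -/
def IsLipschitzConstant (f : (Fin n → ℝ) → ℝ) (C : ℝ) : Prop :=
  0 ≤ C ∧ ∀ x y, ENNReal.ofReal |f x - f y| ≤ ENNReal.ofReal C * G.dist x y

/-- `f : G → ℝ` is Lipschitz with respect to the CC distance. -/
def IsLipschitz (f : (Fin n → ℝ) → ℝ) : Prop := ∃ C, G.IsLipschitzConstant f C

/-- `Lip(f)`, the least Lipschitz constant of a Lipschitz function. -/
def lip (f : (Fin n → ℝ) → ℝ) : ℝ := sInf {C | G.IsLipschitzConstant f C}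

/-- The directional derivative `Ef(x)` exists and equals `v`. -/
def HasDirDeriv (f : (Fin n → ℝ) → ℝ) (x : Fin n → ℝ) (E : 𝔤) (v : ℝ) : Prop :=
  Tendsto (fun t : ℝ => (f (G.mul x (G.exp (t • E))) - f x) / t) (𝓝[≠] 0) (𝓝 v)

/-- `L : G → ℝ` is a homomorphism that commutes with the dilations. -/
def IsGLinear (L : (Fin n → ℝ) → ℝ) : Prop :=
  (∀ x y, L (G.mul x y) = L x + L y) ∧ ∀ r : ℝ, 0 < r → ∀ x, L (G.dilation r x) = r * L x

/-- `f` is Pansu differentiable at `x`: `f(y) - f(x) - L(x⁻¹y) = o(d(x, y))` as `d(x, y) → 0`, for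
some `G`-linear `L`. The inverse of `x` is `-x` in exponential coordinates. -/
def PansuDifferentiableAt (f : (Fin n → ℝ) → ℝ) (x : Fin n → ℝ) : Prop :=
  ∃ L : (Fin n → ℝ) → ℝ, G.IsGLinear L ∧
    (fun y => f y - f x - L (G.mul (-x) y)) =o[comap (fun y => G.dist x y) (𝓝 0)]
      fun y => (G.dist x y).toReal

/-- The CC distance is differentiable in horizontal directions: `d(·) = d(·, 0)` is Pansu
differentiable at every `exp E` with `E ∈ V₁`, `E ≠ 0`. -/
def DistDifferentiableInHorizontalDirections : Prop :=
  ∀ E ∈ G.layer 1, E ≠ 0 → G.PansuDifferentiableAt G.distZero (G.exp E)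

end

end CarnotGroup

/-! If the distance is differentiable, its Pansu differential at `exp E` with `ω(E) = 1` must be the
inner product with `E`. The projection to `V₁` is 1-Lipschitz, so `d(exp(E) v) ≥ 1 + ⟨E, v⟩` with
equality at `v = 0`. Hence the differential dominates `⟨E, ·⟩`, and replacing `v` by its inverse
gives equality (`distZero_mul_exp_approx`).

Now let `f` have Lipschitz constant `ℓ` and `Ef(x) = ℓ`, and let `z = xw` with `d(w) = t`. Set `s =
t / η` with `η` small. The value of `f` at `x exp(±sE)` is `f(x) ± sℓ` up to `o(t)`. By left
invariance and dilation the distance from that point to `z` is `s ∓ ⟨E, w⟩` up to a small multiple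
of `t`. The Lipschitz bound from the forward point bounds `f(z)` below, and the one from the
backward point bounds it above, both by `f(x) + ℓ⟨E, w⟩` up to a small multiple of `t`
(`pansuDifferentiableAt_of_hasDirDeriv_lip`).

Conversely, apply the implication to the distance itself: it has Lipschitz constant 1 and grows at
unit rate along horizontal rays, because `d(exp E) = ω(E)`.

Most of the work is to extract the group axioms, the dilation automorphisms and the additivity of
degree-one coordinates from the integral formula for `mul`. A faithful nilpotent representation
turns that formula into multiplication of operators (`coordRep_mul`, `expRep_mul`). Chow's theorem
is not needed: infinite distances are carried along. -/

/-! ### Truncated exponential and logarithm of nilpotent elements -/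

section Truncated

open Polynomial

variable {A : Type*} [Ring A] [Algebra ℝ A]

/-- The exponential series, truncated at order `K`. -/
noncomputable def truncExp (K : ℕ) (a : A) : A := ∑ k ∈ Finset.range K, ((k ! : ℝ)⁻¹) • a ^ k

/-- The series of `(exp a - 1) / a`, truncated at order `K`. -/
noncomputable def truncPhi (K : ℕ) (a : A) : A := ∑ k ∈ Finset.range K, (((k + 1)! : ℝ)⁻¹) • a ^ k

/-- The series of `log (1 + a)`, truncated at order `K`. -/
noncomputable def truncLog (K : ℕ) (a : A) : A :=
  ∑ m ∈ Finset.range K, ((-1 : ℝ) ^ m / ((m : ℝ) + 1)) • a ^ (m + 1)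

theorem truncExp_succ (K : ℕ) (a : A) : truncExp (K + 1) a = 1 + a * truncPhi K a := by
  simp only [truncExp, truncPhi, Finset.sum_range_succ', Finset.mul_sum, mul_smul_comm, pow_succ']
  simp [add_comm]

theorem aeval_truncExp (K : ℕ) (a : A) (p : ℝ[X]) :
    aeval a (truncExp K p) = truncExp K (aeval a p) := by
  simp [truncExp, map_sum]

theorem aeval_truncPhi (K : ℕ) (a : A) (p : ℝ[X]) :
    aeval a (truncPhi K p) = truncPhi K (aeval a p) := by
  simp [truncPhi, map_sum]

theorem aeval_truncLog (K : ℕ) (a : A) (p : ℝ[X]) :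
    aeval a (truncLog K p) = truncLog K (aeval a p) := by
  simp [truncLog, map_sum]

theorem derivative_truncExp_succ (K : ℕ) (p : ℝ[X]) :
    derivative (truncExp (K + 1) p) = truncExp K p * derivative p := by
  rw [truncExp, truncExp, Finset.sum_range_succ', Finset.sum_mul, derivative_add, derivative_sum]
  simp only [pow_zero, derivative_smul, derivative_one, smul_zero, add_zero]
  refine Finset.sum_congr rfl fun k _ => ?_
  rw [derivative_pow_succ, ← C_mul', ← C_mul']
  have : ((k + 1)! : ℝ)⁻¹ * ((k : ℝ) + 1) = (k ! : ℝ)⁻¹ := by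
    rw [Nat.factorial_succ]; push_cast; field_simp
  rw [← this]
  simp only [map_mul, map_add, map_one]
  simp
  ring

theorem derivative_truncLog (K : ℕ) (p : ℝ[X]) :
    derivative (truncLog K p) = (∑ m ∈ Finset.range K, (-p) ^ m) * derivative p := by
  rw [truncLog, Finset.sum_mul, derivative_sum]
  refine Finset.sum_congr rfl fun m _ => ?_
  rw [derivative_smul, derivative_pow_succ, ← C_mul', neg_pow p m]
  have : (-1 : ℝ) ^ m / ((m : ℝ) + 1) * ((m : ℝ) + 1) = (-1) ^ m := by
    field_simp
  have h2 : C ((-1 : ℝ) ^ m / ((m : ℝ) + 1)) * (C ((m : ℝ) + 1)) = (-1) ^ m := by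
    rw [← C_mul, this]; simp
  rw [← h2]
  simp
  ring

theorem one_add_mul_derivative_truncLog (K : ℕ) (p : ℝ[X]) :
    (1 + p) * derivative (truncLog K p) = (1 - (-p) ^ K) * derivative p := by
  rw [derivative_truncLog, ← mul_assoc]
  congr 1
  have := mul_neg_geom_sum (-p) K
  rwa [sub_neg_eq_add] at this

/-- A polynomial that vanishes at `0` and solves `(1 + u) q' = w q` modulo `X ^ K`, where `X ∣ u`,
vanishes modulo `X ^ (K + 1)`. -/
theorem X_pow_dvd_of_ode {K : ℕ} (q u w : ℝ[X]) (hu : X ∣ u) (h0 : q.coeff 0 = 0)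
    (h : X ^ K ∣ (1 + u) * derivative q - w * q) : X ^ (K + 1) ∣ q := by
  have main : ∀ i ≤ K + 1, X ^ i ∣ q := by
    intro i
    induction i with
    | zero => simp
    | succ i ih =>
      intro hi
      obtain ⟨r, hr⟩ := ih (by omega)
      rcases Nat.eq_zero_or_pos i with rfl | hpos
      · simpa using X_dvd_iff.2 h0
      obtain ⟨i, rfl⟩ : ∃ j, i = j + 1 := ⟨i - 1, by omega⟩
      have h1 : X ^ (i + 1) ∣ (1 + u) * derivative q - w * q := dvd_trans (pow_dvd_pow _ (by omega)) h
      have h2 : X ^ (i + 1) ∣ w * q := (Dvd.intro r hr.symm).mul_left w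
      have h3 : X ^ (i + 1) ∣ (1 + u) * derivative q := by
        have := dvd_add h1 h2
        simpa using this
      -- The order improves by one: `q'` has order at least `i`, so `u q'` has order at least `i +
      -- 1` and can be subtracted from `(1 + u) q'`.
      have h4 : X ^ i ∣ derivative q := by
        rw [hr, derivative_mul, derivative_X_pow_succ]
        exact dvd_add ((Dvd.intro_left _ rfl).mul_right _) ((pow_dvd_pow _ (by omega)).mul_right _)
      have h5 : X ^ (i + 1) ∣ u * derivative q := by
        rw [pow_succ']; exact mul_dvd_mul hu h4
      have h6 : X ^ (i + 1) ∣ derivative q := by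
        have := dvd_sub h3 h5
        have e : (1 + u) * derivative q - u * derivative q = derivative q := by ring
        rwa [e] at this
      rw [X_pow_dvd_iff] at h6 ⊢
      intro d hd
      rcases Nat.eq_zero_or_pos d with rfl | hd0
      · exact h0
      obtain ⟨d, rfl⟩ : ∃ j, d = j + 1 := ⟨d - 1, by omega⟩
      have := h6 d (by omega)
      rw [coeff_derivative] at this
      rcases mul_eq_zero.1 this with h | h
      · exact h
      · exact absurd h (by positivity)
  exact main _ le_rfl

theorem X_dvd_truncLog_X (K : ℕ) : (X : ℝ[X]) ∣ truncLog K X :=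
  Finset.dvd_sum fun m _ => by
    rw [pow_succ', ← C_mul']
    exact (dvd_mul_right _ _).mul_left _

/-- This is `log(exp X) = X` for formal series. The difference vanishes at 0, and the truncations
spoil the equation for its derivative only by multiples of `X ^ K`. -/
theorem X_pow_dvd_truncLog_exp (K : ℕ) :
    (X : ℝ[X]) ^ (K + 1) ∣ truncLog K (X * truncPhi K X) - X := by
  apply X_pow_dvd_of_ode (K := K) _ (X * truncPhi K X) 0 (dvd_mul_right _ _)
  · have : (X : ℝ[X]) ∣ truncLog K (X * truncPhi K X) - X := by
      refine dvd_sub (Finset.dvd_sum fun m _ => ?_) dvd_rfl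
      rw [pow_succ', ← C_mul', mul_assoc]
      exact (dvd_mul_right _ _).mul_left _
    exact X_dvd_iff.1 this
  · have h1 : derivative ((X : ℝ[X]) * truncPhi K X) = truncExp K X := by
      have := derivative_truncExp_succ K (X : ℝ[X])
      rw [truncExp_succ] at this
      simpa using this
    have h2 := one_add_mul_derivative_truncLog K ((X : ℝ[X]) * truncPhi K X)
    rw [derivative_sub, mul_sub, h2, h1, zero_mul, sub_zero, derivative_X, mul_one]
    have h3 : 1 + (X : ℝ[X]) * truncPhi K X = truncExp K X + ((K ! : ℝ)⁻¹) • X ^ K := by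
      rw [← truncExp_succ, truncExp, Finset.sum_range_succ]; rfl
    rw [h3]
    have : (1 - (-(X * truncPhi K X)) ^ K) * truncExp K X
        - (truncExp K X + ((K ! : ℝ)⁻¹) • (X : ℝ[X]) ^ K)
        = X ^ K * (-(-truncPhi K X) ^ K * truncExp K X - C ((K ! : ℝ)⁻¹)) := by
      rw [← C_mul', ← mul_neg, mul_pow]; ring
    rw [this]
    exact dvd_mul_right _ _

/-- Both `exp(log(1 + X))` and `1 + X` solve `(1 + X) q' = q`, up to truncation errors divisible by
`X ^ K`. -/
theorem X_pow_dvd_truncExp_log (K : ℕ) :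
    (X : ℝ[X]) ^ (K + 1) ∣ truncExp (K + 1) (truncLog K X) - (1 + X) := by
  apply X_pow_dvd_of_ode (K := K) _ X 1 dvd_rfl
  · have : (X : ℝ[X]) ∣ truncExp (K + 1) (truncLog K X) - (1 + X) := by
      rw [truncExp_succ]
      have : 1 + truncLog K (X : ℝ[X]) * truncPhi K (truncLog K X) - (1 + X)
        = truncLog K X * truncPhi K (truncLog K X) - X := by ring
      rw [this]
      exact dvd_sub ((X_dvd_truncLog_X K).mul_right _) dvd_rfl
    exact X_dvd_iff.1 this
  · have h2 := one_add_mul_derivative_truncLog K (X : ℝ[X])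
    have h3 := derivative_truncExp_succ K (truncLog K (X : ℝ[X]))
    have h4 : truncExp (K + 1) (truncLog K (X : ℝ[X]))
        = truncExp K (truncLog K X) + ((K ! : ℝ)⁻¹) • (truncLog K X) ^ K := by
      rw [truncExp, Finset.sum_range_succ]; rfl
    obtain ⟨r, hr⟩ := X_dvd_truncLog_X K
    rw [derivative_sub, h3]
    simp only [derivative_add, derivative_one, derivative_X, zero_add] at h2 ⊢
    have : (1 + X) * (truncExp K (truncLog K (X : ℝ[X])) * derivative (truncLog K X) - 1)
        - 1 * (truncExp (K + 1) (truncLog K X) - (1 + X))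
        = truncExp K (truncLog K X) * ((1 + X) * derivative (truncLog K (X : ℝ[X])))
          - truncExp (K + 1) (truncLog K X) := by ring
    rw [this, h2, h4, hr, ← C_mul', mul_pow]
    refine ⟨-truncExp K (X * r) * (-1) ^ K - C ((K ! : ℝ)⁻¹) * r ^ K, ?_⟩
    rw [neg_pow (X : ℝ[X]) K]
    ring

theorem truncExp_truncLog {K : ℕ} {a : A} (ha : a ^ K = 0) :
    truncExp K (truncLog K a) = 1 + a := by
  rcases K with _ | K
  · have : Subsingleton A := subsingleton_of_zero_eq_one (by simpa using ha.symm)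
    exact Subsingleton.elim _ _
  obtain ⟨r, hr⟩ := X_pow_dvd_truncExp_log K
  have h := congrArg (aeval a) hr
  rw [map_sub, map_mul, map_pow, aeval_X, ha, zero_mul, aeval_truncExp, aeval_truncLog, aeval_X,
    sub_eq_zero] at h
  have e : truncLog (K + 1) a = truncLog K a := by
    rw [truncLog, Finset.sum_range_succ, ha, smul_zero, add_zero]; rfl
  rw [e, h]
  simp

/-- Formally `log(e^a) / a = 1`. The division by `a` is carried out on polynomials, where `X` can be
cancelled. The identity provides the left inverse of `(e^a - 1) / a`, the factor in the derivative
of the exponential map. -/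
theorem sum_smul_pow_mul_truncPhi {K : ℕ} {a : A} (ha : a ^ K = 0) :
    ∑ m ∈ Finset.range K, ((-1 : ℝ) ^ m / ((m : ℝ) + 1)) •
      ((a * truncPhi K a) ^ m * truncPhi K a) = 1 := by
  obtain ⟨r, hr⟩ := X_pow_dvd_truncLog_exp K
  set P : ℝ[X] := ∑ m ∈ Finset.range K, ((-1 : ℝ) ^ m / ((m : ℝ) + 1)) •
      ((X * truncPhi K X) ^ m * truncPhi K X) with hP
  have h1 : truncLog K ((X : ℝ[X]) * truncPhi K X) = X * P := by
    rw [hP, truncLog, Finset.mul_sum]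
    refine Finset.sum_congr rfl fun m _ => ?_
    rw [mul_smul_comm, pow_succ]
    congr 1
    ring
  have h2 : P - 1 = X ^ K * r := by
    have : (X : ℝ[X]) * (P - 1) = X * (X ^ K * r) := by rw [mul_sub, mul_one, ← h1, hr]; ring
    exact mul_left_cancel₀ X_ne_zero this
  have h := congrArg (aeval a) h2
  rw [map_sub, map_mul, map_pow, aeval_X, ha, zero_mul, sub_eq_zero] at h
  simpa [hP, map_sum, aeval_truncPhi] using h

theorem truncLog_truncExp_sub_one {K : ℕ} {a : A} (ha : a ^ K = 0) :
    truncLog K (truncExp K a - 1) = a := by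
  have e : truncExp K a = 1 + a * truncPhi K a := by
    rw [← truncExp_succ, truncExp, truncExp, Finset.sum_range_succ, ha]; simp
  obtain ⟨r, hr⟩ := X_pow_dvd_truncLog_exp K
  have h := congrArg (aeval a) hr
  rw [map_sub, map_mul, map_pow, aeval_X, pow_succ, ha, zero_mul, zero_mul, aeval_truncLog,
    map_mul, aeval_truncPhi, aeval_X, sub_eq_zero] at h
  rw [e, add_sub_cancel_left, h]

end Truncated

/-! ### The exponential map of a Banach algebra at nilpotent elements -/

section NilpotentExp

variable {A : Type*} [NormedRing A] [NormedAlgebra ℝ A]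

theorem hasDerivAt_sum_pow_div_factorial {E : Type*} [NormedAddCommGroup E] [NormedSpace ℝ E]
    (K : ℕ) (a : ℕ → E) (s : ℝ) :
    HasDerivAt (fun s : ℝ => ∑ k ∈ Finset.range (K + 1), (s ^ k * (k ! : ℝ)⁻¹) • a k)
      (∑ k ∈ Finset.range K, (s ^ k * (k ! : ℝ)⁻¹) • a (k + 1)) s := by
  simp only [Finset.sum_range_succ']
  have h : HasDerivAt
      (fun s : ℝ => ∑ k ∈ Finset.range K, (s ^ (k + 1) * ((k + 1)! : ℝ)⁻¹) • a (k + 1))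
      (∑ k ∈ Finset.range K, (s ^ k * (k ! : ℝ)⁻¹) • a (k + 1)) s := by
    refine HasDerivAt.fun_sum fun k _ => ?_
    refine HasDerivAt.smul_const ?_ _
    convert (hasDerivAt_pow (k + 1) s).mul_const (((k + 1)! : ℝ)⁻¹) using 1
    rw [Nat.factorial_succ]
    push_cast
    field_simp
  simpa using h.add_const ((s ^ 0 * (0 ! : ℝ)⁻¹) • a 0)

theorem exp_eq_truncExp {K : ℕ} {a : A} (ha : a ^ K = 0) :
    NormedSpace.exp a = truncExp K a := by
  rw [NormedSpace.exp_eq_tsum ℝ, truncExp]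
  refine tsum_eq_sum fun k hk => ?_
  rw [pow_eq_zero_of_le (by simpa using hk) ha, smul_zero]

variable [CompleteSpace A]

theorem normedSpace_exp_add {a b : A} (h : Commute a b) :
    NormedSpace.exp (a + b) = NormedSpace.exp a * NormedSpace.exp b :=
  letI : NormedAlgebra ℚ A := NormedAlgebra.restrictScalars ℚ ℝ A
  NormedSpace.exp_add_of_commute h

theorem continuous_normedSpace_exp : Continuous (NormedSpace.exp : A → A) :=
  letI : NormedAlgebra ℚ A := NormedAlgebra.restrictScalars ℚ ℝ A
  NormedSpace.exp_continuous

theorem normedSpace_exp_mul_exp_neg (a : A) : NormedSpace.exp a * NormedSpace.exp (-a) = 1 := by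
  rw [← normedSpace_exp_add (Commute.refl a).neg_right, add_neg_cancel, NormedSpace.exp_zero]

theorem normedSpace_exp_neg_mul_exp (a : A) : NormedSpace.exp (-a) * NormedSpace.exp a = 1 := by
  rw [← normedSpace_exp_add (Commute.refl a).neg_left, neg_add_cancel, NormedSpace.exp_zero]

theorem truncExp_smul_apply {E : Type*} [AddCommGroup E] [Module ℝ E] (K : ℕ)
    (T : Module.End ℝ E) (s : ℝ) (v : E) :
    truncExp K (s • T) v = ∑ k ∈ Finset.range K, (s ^ k * (k ! : ℝ)⁻¹) • (T ^ k) v := by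
  simp only [truncExp, LinearMap.sum_apply, LinearMap.smul_apply, smul_pow, smul_smul, mul_comm]

/-- The inner derivation `H ↦ ZH - HZ`. -/
noncomputable def commutatorEnd {A : Type*} [Ring A] [Algebra ℝ A] (Z : A) : Module.End ℝ A :=
  LinearMap.mulLeft ℝ Z - LinearMap.mulRight ℝ Z

theorem commutatorEnd_apply {A : Type*} [Ring A] [Algebra ℝ A] (Z H : A) :
    commutatorEnd Z H = Z * H - H * Z := rfl

theorem isNilpotent_commutatorEnd {A : Type*} [Ring A] [Algebra ℝ A] {Z : A}
    (hZ : IsNilpotent Z) : IsNilpotent (commutatorEnd Z) :=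
  (LinearMap.commute_mulLeft_right Z Z).isNilpotent_sub
    ((LinearMap.isNilpotent_mulLeft_iff ℝ Z).2 hZ) ((LinearMap.isNilpotent_mulRight_iff ℝ Z).2 hZ)

/-- The truncated series `q` solves `q' = Zq - qZ`, so conjugating it back by `exp(sZ)` gives a
function of `s` with zero derivative. -/
theorem exp_smul_conj_eq_truncExp_commutatorEnd {K : ℕ} {Z : A} (hZ : (commutatorEnd Z) ^ K = 0) (H : A)
    (s : ℝ) :
    NormedSpace.exp (s • Z) * H * NormedSpace.exp (-(s • Z)) =
      truncExp K (s • commutatorEnd Z) H := by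
  set N := commutatorEnd Z with hN
  set q : ℝ → A := fun s => truncExp K (s • N) H with hq
  have hq' : ∀ s, HasDerivAt q (Z * q s - q s * Z) s := by
    intro s
    have e1 : ∀ v, Z * v - v * Z = N v := fun v => rfl
    rw [e1]
    rcases K with _ | K
    · simp only [hq, truncExp, Finset.range_zero, Finset.sum_empty, LinearMap.zero_apply, map_zero]
      exact hasDerivAt_const _ _
    · have := hasDerivAt_sum_pow_div_factorial K (fun k => (N ^ k) H) s
      simp only [hq, truncExp_smul_apply]
      refine this.congr_deriv ?_
      rw [map_sum, Finset.sum_range_succ, map_smul, ← Module.End.mul_apply, ← pow_succ', hZ]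
      simp [← Module.End.mul_apply, ← pow_succ']
  set f : ℝ → A := fun s => NormedSpace.exp (s • (-Z)) * q s * NormedSpace.exp (s • Z) with hf
  have hf' : ∀ s, HasDerivAt f 0 s := by
    intro s
    have h1 := hasDerivAt_exp_smul_const (𝕂 := ℝ) (-Z) s
    have h2 := hasDerivAt_exp_smul_const' (𝕂 := ℝ) Z s
    refine ((h1.mul (hq' s)).mul h2).congr_deriv ?_
    simp only [Pi.mul_apply]
    noncomm_ring
  have hc : f s = f 0 :=
    is_const_of_deriv_eq_zero (fun s => (hf' s).differentiableAt) (fun s => (hf' s).deriv) s 0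
  have h0 : f 0 = H := by
    have hq0 : q 0 = H := by
      rcases K with _ | K
      · have : H = (N ^ 0) H := by simp
        rw [hZ] at this
        simp only [hq, truncExp, Finset.range_zero, Finset.sum_empty]
        exact this.symm
      · simp [hq, truncExp_smul_apply, Finset.sum_range_succ']
    simp [hf, hq0]
  rw [h0] at hc
  have : NormedSpace.exp (s • Z) * f s * NormedSpace.exp (-(s • Z)) = q s := by
    simp only [hf, smul_neg]
    rw [mul_assoc, mul_assoc, normedSpace_exp_mul_exp_neg, mul_one, ← mul_assoc,
      normedSpace_exp_mul_exp_neg, one_mul]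
  rwa [hc] at this

theorem exp_conj_eq_truncExp_commutatorEnd {K : ℕ} {Z : A} (hZ : (commutatorEnd Z) ^ K = 0) (H : A) :
    NormedSpace.exp Z * H * NormedSpace.exp (-Z) = truncExp K (commutatorEnd Z) H := by
  simpa using exp_smul_conj_eq_truncExp_commutatorEnd hZ H 1

/-- Integrates the derivative of `exp(sP) exp(-sQ)`; `P` and `Q` need not commute. -/
theorem exp_mul_exp_neg_sub_one (P Q : A) :
    NormedSpace.exp P * NormedSpace.exp (-Q) - 1 =
      ∫ s in (0 : ℝ)..1, NormedSpace.exp (s • P) * (P - Q) * NormedSpace.exp (-(s • Q)) := by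
  have h : ∀ s : ℝ, HasDerivAt
      (fun s : ℝ => NormedSpace.exp (s • P) * NormedSpace.exp (s • (-Q)))
      (NormedSpace.exp (s • P) * (P - Q) * NormedSpace.exp (-(s • Q))) s := by
    intro s
    refine ((hasDerivAt_exp_smul_const (𝕂 := ℝ) P s).mul
      (hasDerivAt_exp_smul_const' (𝕂 := ℝ) (-Q) s)).congr_deriv ?_
    rw [← smul_neg]
    noncomm_ring
  have hcont : Continuous fun s : ℝ =>
      NormedSpace.exp (s • P) * (P - Q) * NormedSpace.exp (-(s • Q)) := by
    have := continuous_normedSpace_exp (A := A)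
    fun_prop
  rw [intervalIntegral.integral_eq_sub_of_hasDerivAt (fun s _ => h s)
    (hcont.intervalIntegrable _ _)]
  simp

/-- The derivative of the exponential map along a curve. -/
theorem deriv_exp_mul_exp_neg {Z : ℝ → A} {Z' M' : A} {t : ℝ} (hZc : Continuous Z)
    (hZ : HasDerivAt Z Z' t) (hM : HasDerivAt (fun τ => NormedSpace.exp (Z τ)) M' t) :
    M' * NormedSpace.exp (-Z t) =
      ∫ s in (0 : ℝ)..1, NormedSpace.exp (s • Z t) * Z' * NormedSpace.exp (-(s • Z t)) := by
  -- The difference quotient of `exp(Z τ) exp(-Z t)`, written with `dslope` so that it is continuous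
  -- also at `τ = t`.
  set g : ℝ → A := fun τ => ∫ s in (0 : ℝ)..1,
    NormedSpace.exp (s • Z τ) * dslope Z t τ * NormedSpace.exp (-(s • Z t)) with hg
  have hslope : Continuous (dslope Z t) := by
    rw [← continuousOn_univ, continuousOn_dslope univ_mem]
    exact ⟨hZc.continuousOn, hZ.differentiableAt⟩
  have hgc : Continuous g := by
    refine intervalIntegral.continuous_parametric_intervalIntegral_of_continuous (a₀ := 0) ?_
      continuous_const
    have := continuous_normedSpace_exp (A := A)
    unfold Function.uncurry
    fun_prop
  have hkey : ∀ τ, NormedSpace.exp (Z τ) * NormedSpace.exp (-Z t) - 1 = (τ - t) • g τ := by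
    intro τ
    rw [exp_mul_exp_neg_sub_one, hg, ← intervalIntegral.integral_smul]
    refine intervalIntegral.integral_congr fun s _ => ?_
    rw [← sub_smul_dslope Z t τ, mul_smul_comm, smul_mul_assoc]
  have h1 : HasDerivAt (fun τ => NormedSpace.exp (Z τ) * NormedSpace.exp (-Z t))
      (M' * NormedSpace.exp (-Z t)) t := hM.mul_const _
  have h2 : HasDerivAt (fun τ => NormedSpace.exp (Z τ) * NormedSpace.exp (-Z t)) (g t) t := by
    rw [hasDerivAt_iff_tendsto_slope]
    refine (hgc.continuousAt.tendsto.mono_left nhdsWithin_le_nhds).congr' ?_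
    filter_upwards [self_mem_nhdsWithin] with τ hτ
    rw [slope_def_module, normedSpace_exp_mul_exp_neg, hkey, smul_smul,
      inv_mul_cancel₀ (sub_ne_zero.2 hτ), one_smul]
  rw [h1.unique h2, hg]
  simp [hZ.deriv]

theorem integral_truncExp_smul_apply {E : Type*} [NormedAddCommGroup E] [NormedSpace ℝ E]
    [CompleteSpace E] (K : ℕ) (T : Module.End ℝ E) (v : E) :
    ∫ s in (0 : ℝ)..1, truncExp K (s • T) v = truncPhi K T v := by
  have h := fun s : ℝ => hasDerivAt_sum_pow_div_factorial K
    (fun k => if k = 0 then 0 else (T ^ (k - 1)) v) s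
  simp only [Nat.add_eq_zero_iff, one_ne_zero, and_false, if_false, Nat.add_sub_cancel,
    ← truncExp_smul_apply] at h
  rw [intervalIntegral.integral_eq_sub_of_hasDerivAt (fun s _ => h s)]
  · simp [Finset.sum_range_succ', truncPhi]
  · refine Continuous.intervalIntegrable ?_ _ _
    simp only [truncExp_smul_apply]
    fun_prop

/-- The differential form of the Baker-Campbell-Hausdorff formula. -/
theorem hasDerivAt_log_of_mul {K : ℕ} {Z : ℝ → A} {Z' Y : A} {t : ℝ} (hZc : Continuous Z)
    (hZ : HasDerivAt Z Z' t)
    (hM : HasDerivAt (fun τ => NormedSpace.exp (Z τ)) (NormedSpace.exp (Z t) * Y) t)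
    (hK : (commutatorEnd (Z t)) ^ K = 0) :
    Z' = (∑ m ∈ Finset.range K, ((-1 : ℝ) ^ m / ((m : ℝ) + 1)) •
      ((truncExp K (commutatorEnd (Z t)) - 1) ^ m * truncExp K (commutatorEnd (Z t)))) Y := by
  set N := commutatorEnd (Z t) with hN
  have h1 := deriv_exp_mul_exp_neg hZc hZ hM
  simp only [exp_smul_conj_eq_truncExp_commutatorEnd hK, ← hN, integral_truncExp_smul_apply] at h1
  rw [exp_conj_eq_truncExp_commutatorEnd hK, ← hN] at h1
  have e : truncExp K N - 1 = N * truncPhi K N := by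
    rw [sub_eq_iff_eq_add', ← truncExp_succ, truncExp, truncExp, Finset.sum_range_succ, hK]
    simp
  -- At this point `h1` reads `e^N Y = φ(N) Z'` with `φ(N) = (e^N - 1) / N`; the left inverse of
  -- `φ(N)` recovers `Z'`.
  have h2 := congrArg (fun T : Module.End ℝ A => T Z') (sum_smul_pow_mul_truncPhi hK)
  simp only [LinearMap.sum_apply, LinearMap.smul_apply, Module.End.mul_apply, Module.End.one_apply]
    at h2 ⊢
  rw [← h2]
  simp only [e, h1]

end NilpotentExp

/-! ### Endomorphisms that raise a filtration -/

section Filtration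

variable {V : Type*} [AddCommGroup V] [Module ℝ V]

/-- The endomorphisms that map `F k` to `F (k + a)` for all `k`. -/
def raisingEnd (F : ℕ → Submodule ℝ V) (a : ℕ) : Submodule ℝ (Module.End ℝ V) where
  carrier := {T | ∀ k, ∀ v ∈ F k, T v ∈ F (k + a)}
  add_mem' hS hT k v hv := (F _).add_mem (hS k v hv) (hT k v hv)
  zero_mem' _ _ _ := (F _).zero_mem
  smul_mem' c _ hT k v hv := (F _).smul_mem c (hT k v hv)

variable {F : ℕ → Submodule ℝ V} {a b : ℕ} {S T : Module.End ℝ V}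

theorem mul_mem_raisingEnd (hS : S ∈ raisingEnd F a) (hT : T ∈ raisingEnd F b) :
    S * T ∈ raisingEnd F (a + b) := fun k v hv => by
  have := hS _ _ (hT k v hv)
  rwa [add_assoc, add_comm b a] at this

theorem raisingEnd_antitone (hF : Antitone F) : Antitone (raisingEnd F) :=
  fun _ _ h _ hT k v hv => hF (Nat.add_le_add_left h k) (hT k v hv)

theorem pow_mem_raisingEnd (hT : T ∈ raisingEnd F 1) (m : ℕ) : T ^ m ∈ raisingEnd F m := by
  induction m with
  | zero => exact fun k v hv => hv
  | succ m ih => exact mul_mem_raisingEnd ih hT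

theorem pow_eq_zero_of_mem_raisingEnd {N : ℕ} (h0 : F 0 = ⊤) (hN : F N = ⊥)
    (hT : T ∈ raisingEnd F 1) : T ^ N = 0 := by
  ext v
  have := pow_mem_raisingEnd hT N 0 v (by simp [h0])
  rwa [zero_add, hN, Submodule.mem_bot] at this

theorem truncExp_sub_mem_raisingEnd (hF : Antitone F) (hT : T ∈ raisingEnd F 1) (K : ℕ) :
    truncExp (K + 2) T - 1 - T ∈ raisingEnd F 2 := by
  have : truncExp (K + 2) T - 1 - T
      = ∑ k ∈ Finset.range K, (((k + 2)! : ℝ)⁻¹) • T ^ (k + 2) := by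
    rw [truncExp, Finset.sum_range_succ', Finset.sum_range_succ']
    simp
  rw [this]
  exact Submodule.sum_mem _ fun k _ => Submodule.smul_mem _ _
    (raisingEnd_antitone hF (by omega) (pow_mem_raisingEnd hT (k + 2)))

theorem truncExp_sub_one_mem_raisingEnd (hF : Antitone F) (hT : T ∈ raisingEnd F 1) (K : ℕ) :
    truncExp (K + 1) T - 1 ∈ raisingEnd F 1 := by
  rw [truncExp_succ, add_sub_cancel_left, truncPhi, Finset.mul_sum]
  refine Submodule.sum_mem _ fun k _ => ?_
  rw [mul_smul_comm, ← pow_succ']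
  exact Submodule.smul_mem _ _ (raisingEnd_antitone hF (by omega) (pow_mem_raisingEnd hT (k + 1)))

theorem mul_sub_one_eq {R : Type*} [Ring R] (a b : R) :
    a * b - 1 = (a - 1) * (b - 1) + (a - 1) + (b - 1) := by
  rw [sub_mul, mul_sub, mul_one, one_mul]; abel

theorem mul_sub_one_mem_raisingEnd (hF : Antitone F) (hS : S - 1 ∈ raisingEnd F 1)
    (hT : T - 1 ∈ raisingEnd F 1) : S * T - 1 ∈ raisingEnd F 1 := by
  rw [mul_sub_one_eq]
  exact add_mem (add_mem (raisingEnd_antitone hF (by omega) (mul_mem_raisingEnd hS hT)) hS) hT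

end Filtration

namespace CarnotGroup

noncomputable section

variable {𝔤 : Type*} [LieRing 𝔤] [LieAlgebra ℝ 𝔤] {n : ℕ} (G : CarnotGroup 𝔤 n)

/-! ### The grading of the Lie algebra -/

/-- Induction on `i`: `V_{i+1}` is spanned by brackets with `V₁`, and the Jacobi identity reduces to
brackets with `V₁` and with `V_i`. -/
theorem lie_mem_layer {i j : ℕ} {a b : 𝔤} (ha : a ∈ G.layer i) (hb : b ∈ G.layer j) :
    ⁅a, b⁆ ∈ G.layer (i + j) := by
  have hbr : ∀ {j : ℕ} {a b : 𝔤}, a ∈ G.layer 1 → b ∈ G.layer j → ⁅a, b⁆ ∈ G.layer (j + 1) := by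
    intro j a b ha hb
    rcases Nat.eq_zero_or_pos j with rfl | hj
    · rw [G.layer_zero, Submodule.mem_bot] at hb
      simp [hb]
    · rw [G.layer_succ j hj]
      exact Submodule.subset_span ⟨a, ha, b, hb, rfl⟩
  induction i generalizing j a b with
  | zero =>
    rw [G.layer_zero, Submodule.mem_bot] at ha
    simp [ha]
  | succ i ih =>
    rcases Nat.eq_zero_or_pos i with rfl | hi
    · rw [zero_add, add_comm]
      exact hbr ha hb
    rw [G.layer_succ i hi] at ha
    induction ha using Submodule.span_induction with
    | mem z hz =>
      obtain ⟨c, hc, d, hd, rfl⟩ := hz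
      rw [lie_lie]
      have h1 := hbr hc (ih hd hb)
      have h2 := ih hd (hbr hc hb)
      rw [show i + 1 + j = i + j + 1 by omega]
      rw [show i + (j + 1) = i + j + 1 by omega] at h2
      exact sub_mem h1 h2
    | zero => simp
    | add x y _ _ hx hy => rw [add_lie]; exact add_mem hx hy
    | smul c x _ hx => rw [smul_lie]; exact Submodule.smul_mem _ _ hx

/-- The part of `v` along basis vectors of other degrees lies both in `V_d` and in the sum of the
other layers, so it vanishes by independence. -/
theorem repr_eq_zero_of_mem_layer {d : ℕ} {v : 𝔤} (hv : v ∈ G.layer d) {j : Fin n}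
    (hj : G.deg j ≠ d) : G.basis.repr v j = 0 := by
  classical
  set p : 𝔤 := ∑ i, if G.deg i = d then G.basis.repr v i • G.basis i else 0 with hp
  set q : 𝔤 := ∑ i, if G.deg i = d then 0 else G.basis.repr v i • G.basis i with hq
  have hpq : v = p + q := by
    rw [hp, hq, ← Finset.sum_add_distrib]
    conv_lhs => rw [← G.basis.sum_repr v]
    exact Finset.sum_congr rfl fun i _ => by split_ifs <;> simp
  have hp1 : p ∈ G.layer d := Submodule.sum_mem _ fun i _ => by
    split_ifs with h
    · exact Submodule.smul_mem _ _ (h ▸ G.basis_mem i)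
    · exact zero_mem _
  have hq1 : q ∈ G.layer d := by
    have : q = v - p := by rw [hpq]; abel
    rw [this]; exact sub_mem hv hp1
  have hq2 : q ∈ ⨆ e ≠ d, G.layer e := Submodule.sum_mem _ fun i _ => by
    split_ifs with h
    · exact zero_mem _
    · exact Submodule.smul_mem _ _
        (Submodule.mem_iSup_of_mem (G.deg i) (Submodule.mem_iSup_of_mem h (G.basis_mem i)))
  have hq0 : q = 0 :=
    Submodule.disjoint_def.1 (G.isInternal.submodule_iSupIndep d) q hq1 hq2
  have h2 : G.basis.repr q j = G.basis.repr v j := by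
    rw [hq, map_sum, Finsupp.finsetSum_apply, Finset.sum_eq_single j]
    · simp [hj]
    · intro i _ hij
      split_ifs <;> simp [hij]
    · simp
  rw [← h2, hq0]; simp

theorem one_le_deg (j : Fin n) : 1 ≤ G.deg j := by
  by_contra h
  have h0 : G.deg j = 0 := by omega
  have := G.basis_mem j
  rw [h0, G.layer_zero, Submodule.mem_bot] at this
  exact G.basis.ne_zero j this

theorem deg_le_step (j : Fin n) : G.deg j ≤ G.step := by
  by_contra h
  have := G.basis_mem j
  rw [G.layer_eq_bot _ (by omega), Submodule.mem_bot] at this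
  exact G.basis.ne_zero j this

/-- The ideal `⨁ i ≥ k, V_i`. -/
def fil (k : ℕ) : Submodule ℝ 𝔤 where
  carrier := {v | ∀ j, G.deg j < k → G.basis.repr v j = 0}
  add_mem' ha hb j hj := by simp [ha j hj, hb j hj]
  zero_mem' j _ := by simp
  smul_mem' c _ ha j hj := by simp [ha j hj]

theorem fil_antitone : Antitone G.fil := fun _ _ h _ hv j hj => hv j (lt_of_lt_of_le hj h)

theorem fil_one : G.fil 1 = ⊤ := by
  refine eq_top_iff.2 fun v _ j hj => ?_
  have := G.one_le_deg j
  omega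

theorem fil_succ_step : G.fil (G.step + 1) = ⊥ := by
  refine eq_bot_iff.2 fun v hv => ?_
  refine G.basis.ext_elem fun j => ?_
  rw [hv j (Nat.lt_succ_of_le (G.deg_le_step j))]
  simp

theorem layer_le_fil (d : ℕ) : G.layer d ≤ G.fil d :=
  fun _ hv _ hj => G.repr_eq_zero_of_mem_layer hv hj.ne

theorem lie_mem_fil {i k : ℕ} {a b : 𝔤} (ha : a ∈ G.fil i) (hb : b ∈ G.fil k) :
    ⁅a, b⁆ ∈ G.fil (i + k) := by
  rw [← G.basis.sum_repr a, ← G.basis.sum_repr b, sum_lie]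
  simp only [lie_sum]
  refine Submodule.sum_mem _ fun p _ => Submodule.sum_mem _ fun q _ => ?_
  rw [smul_lie, lie_smul]
  by_cases h1 : G.deg p < i
  · rw [ha p h1]; simp
  by_cases h2 : G.deg q < k
  · rw [hb q h2]; simp
  refine Submodule.smul_mem _ _ (Submodule.smul_mem _ _ ?_)
  exact G.fil_antitone (by omega)
    (G.layer_le_fil _ (G.lie_mem_layer (G.basis_mem p) (G.basis_mem q)))

/-- The derivation of the Lie algebra that multiplies `V_i` by `i`. -/
def gradingDerivation : 𝔤 →ₗ[ℝ] 𝔤 := G.basis.constr ℝ fun j => (G.deg j : ℝ) • G.basis j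

theorem repr_gradingDerivation (v : 𝔤) (j : Fin n) :
    G.basis.repr (G.gradingDerivation v) j = G.deg j * G.basis.repr v j := by
  rw [gradingDerivation, Module.Basis.constr_apply_fintype, map_sum, Finsupp.finsetSum_apply,
    Finset.sum_eq_single j]
  · simp [mul_comm]
  · intro i _ hij
    simp [hij]
  · simp

theorem gradingDerivation_of_mem_layer {d : ℕ} {v : 𝔤} (hv : v ∈ G.layer d) :
    G.gradingDerivation v = (d : ℝ) • v := by
  refine G.basis.ext_elem fun j => ?_
  rw [repr_gradingDerivation]
  by_cases h : G.deg j = d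
  · simp [h]
  · simp [G.repr_eq_zero_of_mem_layer hv h]

theorem gradingDerivation_lie (a b : 𝔤) :
    G.gradingDerivation ⁅a, b⁆ = ⁅G.gradingDerivation a, b⁆ + ⁅a, G.gradingDerivation b⁆ := by
  conv_lhs => rw [← G.basis.sum_repr a, ← G.basis.sum_repr b]
  conv_rhs => rw [← G.basis.sum_repr a, ← G.basis.sum_repr b]
  simp only [map_sum, sum_lie_sum, ← Finset.sum_add_distrib]
  refine Finset.sum_congr rfl fun p _ => Finset.sum_congr rfl fun q _ => ?_
  simp only [smul_lie, lie_smul, map_smul,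
    G.gradingDerivation_of_mem_layer (G.lie_mem_layer (G.basis_mem p) (G.basis_mem q)),
    G.gradingDerivation_of_mem_layer (G.basis_mem _)]
  rw [Nat.cast_add]
  module

theorem ad_mem_raisingEnd (X : 𝔤) :
    LieAlgebra.ad ℝ 𝔤 X ∈ raisingEnd (fun k => G.fil (k + 1)) 1 := fun k v hv => by
  have := G.lie_mem_fil (i := 1) (a := X) (by simp [G.fil_one]) hv
  rwa [add_comm] at this

/-- Shows that the truncation in `bchKernel` loses nothing. The filtration starts at `fil 1 = ⊤`,
which gives the exponent `step` and not `step + 1`. -/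
theorem expAd_mul_sub_one_pow (X Y : 𝔤) : (G.expAd X * G.expAd Y - 1) ^ G.step = 0 := by
  have hF : Antitone fun k => G.fil (k + 1) := fun _ _ h => G.fil_antitone (by omega)
  exact pow_eq_zero_of_mem_raisingEnd (F := fun k => G.fil (k + 1)) G.fil_one G.fil_succ_step
    (mul_sub_one_mem_raisingEnd hF
      (truncExp_sub_one_mem_raisingEnd hF (G.ad_mem_raisingEnd X) _)
      (truncExp_sub_one_mem_raisingEnd hF (G.ad_mem_raisingEnd Y) _))

theorem ad_pow_step (X : 𝔤) : (LieAlgebra.ad ℝ 𝔤 X) ^ G.step = 0 :=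
  pow_eq_zero_of_mem_raisingEnd (F := fun k => G.fil (k + 1)) G.fil_one G.fil_succ_step
    (G.ad_mem_raisingEnd X)

end

end CarnotGroup

/-! ### Truncated series: change of truncation order, intertwining, smoothness -/

section Truncated

variable {A : Type*} [Ring A] [Algebra ℝ A]

theorem truncExp_eq_of_le {K L : ℕ} {a : A} (ha : a ^ K = 0) (h : K ≤ L) :
    truncExp L a = truncExp K a := by
  refine (Finset.sum_subset (Finset.range_mono h) fun k _ hk => ?_).symm
  rw [pow_eq_zero_of_le (by simpa using hk) ha, smul_zero]

theorem truncLog_pow_eq_zero {K : ℕ} {a : A} (ha : a ^ K = 0) (L : ℕ) : (truncLog L a) ^ K = 0 := by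
  have h : truncLog L a
      = a * ∑ m ∈ Finset.range L, ((-1 : ℝ) ^ m / ((m : ℝ) + 1)) • a ^ m := by
    rw [truncLog, Finset.mul_sum]
    exact Finset.sum_congr rfl fun m _ => by rw [mul_smul_comm, pow_succ']
  have hc : Commute a (∑ m ∈ Finset.range L, ((-1 : ℝ) ^ m / ((m : ℝ) + 1)) • a ^ m) :=
    Commute.sum_right _ _ _ fun m _ => ((Commute.refl a).pow_right m).smul_right _
  rw [h, hc.mul_pow, ha, zero_mul]

theorem pow_apply_intertwine {E F : Type*} [AddCommGroup E] [Module ℝ E] [AddCommGroup F]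
    [Module ℝ F] (ρ : E →ₗ[ℝ] F) {S : Module.End ℝ E} {T : Module.End ℝ F}
    (h : ∀ v, T (ρ v) = ρ (S v)) (k : ℕ) (v : E) : (T ^ k) (ρ v) = ρ ((S ^ k) v) := by
  induction k generalizing v with
  | zero => simp
  | succ k ih => rw [pow_succ, pow_succ, Module.End.mul_apply, Module.End.mul_apply, h, ih]

theorem truncExp_apply_intertwine {E F : Type*} [AddCommGroup E] [Module ℝ E] [AddCommGroup F]
    [Module ℝ F] (ρ : E →ₗ[ℝ] F) {S : Module.End ℝ E} {T : Module.End ℝ F}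
    (h : ∀ v, T (ρ v) = ρ (S v)) (K : ℕ) (v : E) : truncExp K T (ρ v) = ρ (truncExp K S v) := by
  simp [truncExp, LinearMap.sum_apply, pow_apply_intertwine ρ h]

variable {A : Type*} [NormedRing A] [NormedAlgebra ℝ A] {E : Type*} [NormedAddCommGroup E]
  [NormedSpace ℝ E]

theorem ContDiff.truncExp {m : WithTop ℕ∞} {f : E → A} (hf : ContDiff ℝ m f) (K : ℕ) :
    ContDiff ℝ m fun x => truncExp K (f x) :=
  ContDiff.sum fun k _ => (hf.pow k).const_smul _

theorem ContDiff.truncLog {m : WithTop ℕ∞} {f : E → A} (hf : ContDiff ℝ m f) (K : ℕ) :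
    ContDiff ℝ m fun x => truncLog K (f x) :=
  ContDiff.sum fun k _ => (hf.pow (k + 1)).const_smul _

end Truncated

namespace CarnotGroup

noncomputable section

variable {𝔤 : Type*} [LieRing 𝔤] [LieAlgebra ℝ 𝔤] {n : ℕ} (G : CarnotGroup 𝔤 n)

/-! ### A faithful nilpotent representation -/

theorem log_exp (X : 𝔤) : G.log (G.exp X) = X := G.basis.equivFun.symm_apply_apply X

theorem exp_log (x : Fin n → ℝ) : G.exp (G.log x) = x := G.basis.equivFun.apply_symm_apply x

theorem exp_apply (X : 𝔤) (j : Fin n) : G.exp X j = G.basis.repr X j := rfl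

theorem repr_log (x : Fin n → ℝ) (j : Fin n) : G.basis.repr (G.log x) j = x j := by
  rw [← exp_apply, exp_log]

theorem exp_add (X Y : 𝔤) : G.exp (X + Y) = G.exp X + G.exp Y := map_add _ _ _

theorem exp_sub (X Y : 𝔤) : G.exp (X - Y) = G.exp X - G.exp Y := map_sub _ _ _

theorem exp_smul (c : ℝ) (X : 𝔤) : G.exp (c • X) = c • G.exp X := map_smul _ _ _

theorem exp_zero : G.exp 0 = 0 := map_zero _

theorem log_add (x y : Fin n → ℝ) : G.log (x + y) = G.log x + G.log y := map_add _ _ _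

theorem log_smul (c : ℝ) (x : Fin n → ℝ) : G.log (c • x) = c • G.log x := map_smul _ _ _

theorem log_zero : G.log 0 = 0 := map_zero _

/-- The action of `𝔤` on `𝔤 × ℝ` by the adjoint action of `𝔤` on its extension by the grading
derivation. It is faithful because the grading is positive. -/
def repEnd : 𝔤 →ₗ[ℝ] Module.End ℝ ((Fin n → ℝ) × ℝ) :=
  LinearMap.mk₂ ℝ
    (fun X w => (G.exp (⁅X, G.log w.1⁆ - w.2 • G.gradingDerivation X), (0 : ℝ)))
    (fun X Y w => by
      rw [Prod.mk_add_mk, ← exp_add, add_lie, map_add, smul_add, add_zero]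
      congr 2; module)
    (fun c X w => by
      rw [Prod.smul_mk, ← exp_smul, smul_lie, map_smul, smul_zero, smul_sub, smul_comm])
    (fun X v w => by
      refine Prod.ext ?_ (add_zero 0).symm
      rw [Prod.fst_add, Prod.snd_add, log_add, lie_add, add_smul, Prod.mk_add_mk, ← exp_add]
      refine congrArg G.exp ?_; module)
    (fun c X w => by
      refine Prod.ext ?_ (smul_zero c).symm
      rw [Prod.smul_fst, Prod.smul_snd, log_smul, lie_smul, Prod.smul_mk, ← exp_smul, smul_sub,
        smul_assoc])

theorem repEnd_apply (X : 𝔤) (w : (Fin n → ℝ) × ℝ) :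
    G.repEnd X w = (G.exp (⁅X, G.log w.1⁆ - w.2 • G.gradingDerivation X), (0 : ℝ)) := rfl

/-- The first component is the Jacobi identity; the second is the derivation property of
`gradingDerivation`. -/
theorem repEnd_lie (X Y : 𝔤) :
    G.repEnd ⁅X, Y⁆ = G.repEnd X * G.repEnd Y - G.repEnd Y * G.repEnd X := by
  refine LinearMap.ext fun w => ?_
  simp only [LinearMap.sub_apply, Module.End.mul_apply, repEnd_apply, log_exp, Prod.mk_sub_mk,
    ← exp_sub, zero_smul, sub_zero]
  congr 2
  rw [gradingDerivation_lie, lie_sub, lie_sub, lie_lie, lie_smul, lie_smul, smul_add,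
    ← lie_skew Y (G.gradingDerivation X), smul_neg]
  module

/-- The filtration of `𝔤 × ℝ` by degree, `ℝ` having degree `0`. -/
def extFil (k : ℕ) : Submodule ℝ ((Fin n → ℝ) × ℝ) where
  carrier := {w | G.log w.1 ∈ G.fil k ∧ (0 < k → w.2 = 0)}
  add_mem' ha hb := ⟨by rw [Prod.fst_add, log_add]; exact add_mem ha.1 hb.1,
    fun h => by simp [ha.2 h, hb.2 h]⟩
  zero_mem' := ⟨by simp [log_zero], fun _ => rfl⟩
  smul_mem' c w hw := ⟨by rw [Prod.smul_fst, log_smul]; exact Submodule.smul_mem _ _ hw.1,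
    fun h => by simp [hw.2 h]⟩

theorem mem_extFil {k : ℕ} {w : (Fin n → ℝ) × ℝ} :
    w ∈ G.extFil k ↔ G.log w.1 ∈ G.fil k ∧ (0 < k → w.2 = 0) := Iff.rfl

theorem extFil_antitone : Antitone G.extFil :=
  fun _ _ h _ hw => ⟨G.fil_antitone h hw.1, fun h' => hw.2 (lt_of_lt_of_le h' h)⟩

theorem extFil_zero : G.extFil 0 = ⊤ := by
  refine eq_top_iff.2 fun w _ => ⟨fun j hj => absurd hj (Nat.not_lt_zero _), fun h => ?_⟩
  exact absurd h (lt_irrefl _)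

theorem extFil_succ_step : G.extFil (G.step + 1) = ⊥ := by
  refine eq_bot_iff.2 fun w hw => ?_
  have h1 := hw.1
  rw [fil_succ_step, Submodule.mem_bot] at h1
  have h2 : w.1 = 0 := by rw [← G.exp_log w.1, h1, exp_zero]
  exact (Submodule.mem_bot ℝ).2 (Prod.ext h2 (hw.2 (Nat.succ_pos _)))

theorem repEnd_mem_raisingEnd (X : 𝔤) : G.repEnd X ∈ raisingEnd G.extFil 1 := by
  intro k w hw
  rw [mem_extFil, repEnd_apply]
  refine ⟨?_, fun _ => rfl⟩
  simp only [log_exp]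
  rcases Nat.eq_zero_or_pos k with rfl | hk
  · simp [fil_one]
  · rw [hw.2 hk, zero_smul, sub_zero, add_comm]
    exact G.lie_mem_fil (by simp [fil_one]) hw.1

theorem repEnd_pow (X : 𝔤) : (G.repEnd X) ^ (G.step + 1) = 0 :=
  pow_eq_zero_of_mem_raisingEnd G.extFil_zero G.extFil_succ_step (G.repEnd_mem_raisingEnd X)

/-- `CarnotGroup.repEnd` as a map to a Banach algebra. -/
def rep : 𝔤 →ₗ[ℝ] (((Fin n → ℝ) × ℝ) →L[ℝ] ((Fin n → ℝ) × ℝ)) :=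
  (Module.End.toContinuousLinearMap ((Fin n → ℝ) × ℝ)).toLinearMap ∘ₗ G.repEnd

theorem rep_eq (X : 𝔤) :
    G.rep X = Module.End.toContinuousLinearMap ((Fin n → ℝ) × ℝ) (G.repEnd X) := rfl

theorem rep_apply (X : 𝔤) (w : (Fin n → ℝ) × ℝ) :
    G.rep X w = (G.exp (⁅X, G.log w.1⁆ - w.2 • G.gradingDerivation X), (0 : ℝ)) := rfl

theorem rep_lie (X Y : 𝔤) : G.rep ⁅X, Y⁆ = G.rep X * G.rep Y - G.rep Y * G.rep X := by
  simp only [rep_eq, repEnd_lie, map_sub, map_mul]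

/-- The vector `(0, 1)` is sent to minus the grading derivation of `X`, which determines `X` because
all degrees are positive. The adjoint action alone would kill the centre. -/
theorem rep_injective : Function.Injective G.rep := by
  rw [injective_iff_map_eq_zero]
  intro X hX
  have h := congrArg (fun T : ((Fin n → ℝ) × ℝ) →L[ℝ] ((Fin n → ℝ) × ℝ) => (T (0, 1)).1) hX
  simp only [rep_apply, log_zero, lie_zero, one_smul, zero_sub, _root_.zero_apply,
    Prod.fst_zero] at h
  refine G.basis.ext_elem fun j => ?_
  have hj := congrFun h j
  rw [exp_apply, map_neg, Finsupp.neg_apply, repr_gradingDerivation] at hj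
  have h1 : (G.deg j : ℝ) ≠ 0 := by
    have := G.one_le_deg j
    positivity
  simpa [h1] using hj

theorem rep_pow (X : 𝔤) : (G.rep X) ^ (G.step + 1) = 0 := by
  rw [rep_eq, ← map_pow, repEnd_pow, map_zero]

theorem normedSpace_exp_rep (X : 𝔤) : NormedSpace.exp (G.rep X) =
    Module.End.toContinuousLinearMap ((Fin n → ℝ) × ℝ) (truncExp (G.step + 1) (G.repEnd X)) := by
  rw [exp_eq_truncExp (G.rep_pow X), truncExp, truncExp]
  simp only [rep_eq, map_sum, map_smul, map_pow]

theorem exp_rep_mul_exp_rep_sub_one_pow (X Y : 𝔤) :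
    (NormedSpace.exp (G.rep X) * NormedSpace.exp (G.rep Y) - 1) ^ (G.step + 1) = 0 := by
  rw [normedSpace_exp_rep, normedSpace_exp_rep, ← map_mul,
    ← map_one (Module.End.toContinuousLinearMap ((Fin n → ℝ) × ℝ)), ← map_sub, ← map_pow,
    pow_eq_zero_of_mem_raisingEnd G.extFil_zero G.extFil_succ_step, map_zero]
  exact mul_sub_one_mem_raisingEnd G.extFil_antitone
    (truncExp_sub_one_mem_raisingEnd G.extFil_antitone (G.repEnd_mem_raisingEnd X) _)
    (truncExp_sub_one_mem_raisingEnd G.extFil_antitone (G.repEnd_mem_raisingEnd Y) _)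

/-! ### The Baker-Campbell-Hausdorff formula -/

theorem rep_expAd (X V : 𝔤) :
    NormedSpace.exp (G.rep X) * G.rep V * NormedSpace.exp (-G.rep X) = G.rep (G.expAd X V) := by
  obtain ⟨K, hK⟩ := isNilpotent_commutatorEnd ⟨_, G.rep_pow X⟩
  have hK' : commutatorEnd (G.rep X) ^ (K + G.step) = 0 := pow_eq_zero_of_le (by omega) hK
  rw [exp_conj_eq_truncExp_commutatorEnd hK', truncExp_apply_intertwine G.rep
    (S := LieAlgebra.ad ℝ 𝔤 X)
    (fun v => by rw [commutatorEnd_apply, LieAlgebra.ad_apply, rep_lie])]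
  rw [truncExp_eq_of_le (G.ad_pow_step X) (by omega), expAd, ← truncExp,
    truncExp_eq_of_le (L := G.step + 1) (G.ad_pow_step X) (by omega)]

/-- `log (e^X e^Y)` in the representation. -/
def repLog (X Y : 𝔤) : ((Fin n → ℝ) × ℝ) →L[ℝ] ((Fin n → ℝ) × ℝ) :=
  truncLog (G.step + 1) (NormedSpace.exp (G.rep X) * NormedSpace.exp (G.rep Y) - 1)

theorem exp_repLog (X Y : 𝔤) : NormedSpace.exp (G.repLog X Y) =
    NormedSpace.exp (G.rep X) * NormedSpace.exp (G.rep Y) := by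
  have h := G.exp_rep_mul_exp_rep_sub_one_pow X Y
  rw [repLog, exp_eq_truncExp (truncLog_pow_eq_zero h _), truncExp_truncLog h, add_sub_cancel]

theorem repLog_zero_right (X : 𝔤) : G.repLog X 0 = G.rep X := by
  rw [repLog, map_zero, NormedSpace.exp_zero, mul_one, exp_eq_truncExp (G.rep_pow X),
    truncLog_truncExp_sub_one (G.rep_pow X)]

theorem contDiff_normedSpace_exp_rep {E : Type*} [NormedAddCommGroup E] [NormedSpace ℝ E]
    [FiniteDimensional ℝ E] {m : WithTop ℕ∞} (f : E →ₗ[ℝ] 𝔤) :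
    ContDiff ℝ m fun x => NormedSpace.exp (G.rep (f x)) := by
  simp only [exp_eq_truncExp (G.rep_pow _)]
  exact ContDiff.truncExp (LinearMap.toContinuousLinearMap (G.rep ∘ₗ f)).contDiff _

theorem contDiff_repLog_smul {m : WithTop ℕ∞} (X Y : 𝔤) :
    ContDiff ℝ m fun t : ℝ => G.repLog X (t • Y) := by
  refine ContDiff.truncLog ?_ _
  exact (contDiff_const.mul
    (G.contDiff_normedSpace_exp_rep (LinearMap.toSpanSingleton ℝ 𝔤 Y))).sub contDiff_const

/-- The curve `e^X e^{tY}` has derivative itself times `Y`, so the differential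
Baker-Campbell-Hausdorff formula applies to its logarithm. Conjugation by it corresponds under `rep`
to `e^{ad X} e^{t ad Y}`, and the resulting operator series becomes the integrand of `mul`. -/
theorem hasDerivAt_repLog (X Y : 𝔤) (t : ℝ) : HasDerivAt (fun t : ℝ => G.repLog X (t • Y))
    (G.rep (G.bchKernel (G.expAd X * G.expAd (t • Y)) Y)) t := by
  set Z : ℝ → ((Fin n → ℝ) × ℝ) →L[ℝ] ((Fin n → ℝ) × ℝ) := fun t => G.repLog X (t • Y) with hZdef
  have hZ : HasDerivAt Z (deriv Z t) t :=
    ((G.contDiff_repLog_smul (m := 1) X Y).differentiable one_ne_zero t).hasDerivAt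
  have hM : HasDerivAt (fun τ => NormedSpace.exp (Z τ)) (NormedSpace.exp (Z t) * G.rep Y) t := by
    simp only [hZdef, exp_repLog, map_smul]
    rw [mul_assoc]
    exact (hasDerivAt_exp_smul_const (𝕂 := ℝ) (G.rep Y) t).const_mul _
  obtain ⟨K, hK⟩ := isNilpotent_commutatorEnd (Z := Z t)
    ⟨_, truncLog_pow_eq_zero (G.exp_rep_mul_exp_rep_sub_one_pow X (t • Y)) _⟩
  have hK' : commutatorEnd (Z t) ^ (K + G.step) = 0 := pow_eq_zero_of_le (by omega) hK
  have hderiv := hasDerivAt_log_of_mul (G.contDiff_repLog_smul (m := 1) X Y).continuous hZ hM hK'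
  set Ad := truncExp (K + G.step) (commutatorEnd (Z t)) with hAd
  set B := G.expAd X * G.expAd (t • Y) with hB
  have hinv : NormedSpace.exp (-Z t) =
      NormedSpace.exp (-G.rep (t • Y)) * NormedSpace.exp (-G.rep X) := by
    refine left_inv_eq_right_inv (normedSpace_exp_neg_mul_exp (Z t)) ?_
    rw [exp_repLog, mul_assoc, ← mul_assoc (NormedSpace.exp (G.rep (t • Y))),
      normedSpace_exp_mul_exp_neg, one_mul, normedSpace_exp_mul_exp_neg]
  have hAdB : ∀ V, Ad (G.rep V) = G.rep (B V) := by
    intro V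
    rw [hAd, ← exp_conj_eq_truncExp_commutatorEnd hK', hinv, exp_repLog, hB,
      Module.End.mul_apply, ← rep_expAd, ← rep_expAd]
    simp only [mul_assoc]
  have hterm : ∀ m, ((Ad - 1) ^ m * Ad : Module.End ℝ _) (G.rep Y)
      = G.rep (((B - 1) ^ m * B : Module.End ℝ 𝔤) Y) := by
    intro m
    rw [Module.End.mul_apply, hAdB, Module.End.mul_apply]
    refine pow_apply_intertwine G.rep (fun v => ?_) m _
    rw [LinearMap.sub_apply, LinearMap.sub_apply, hAdB, map_sub]
    rfl
  have hker : G.bchKernel B = ∑ m ∈ Finset.range (K + G.step),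
      ((-1 : ℝ) ^ m / ((m : ℝ) + 1)) • ((B - 1) ^ m * B) := by
    refine Finset.sum_subset (Finset.range_mono (by omega)) fun m _ hm => ?_
    rw [pow_eq_zero_of_le (by simpa using hm) (G.expAd_mul_sub_one_pow X (t • Y)), zero_mul,
      smul_zero]
  have : deriv Z t = G.rep (G.bchKernel B Y) := by
    rw [hderiv, hker]
    simp only [LinearMap.sum_apply, LinearMap.smul_apply, map_sum, map_smul, hterm]
  rwa [this] at hZ

/-- `CarnotGroup.rep` in coordinates. -/
def coordRep : (Fin n → ℝ) →L[ℝ] (((Fin n → ℝ) × ℝ) →L[ℝ] ((Fin n → ℝ) × ℝ)) :=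
  LinearMap.toContinuousLinearMap (G.rep ∘ₗ G.basis.equivFun.symm.toLinearMap)

theorem coordRep_apply (x : Fin n → ℝ) : G.coordRep x = G.rep (G.log x) := rfl

theorem coordRep_injective : Function.Injective G.coordRep :=
  G.rep_injective.comp G.basis.equivFun.symm.injective

/-- Pulls continuity and smoothness in the operator space back to coordinates. -/
theorem exists_leftInverse_coordRep :
    ∃ σ : (((Fin n → ℝ) × ℝ) →L[ℝ] ((Fin n → ℝ) × ℝ)) →L[ℝ] (Fin n → ℝ),
      ∀ x, σ (G.coordRep x) = x := by
  obtain ⟨σ, hσ⟩ := LinearMap.exists_leftInverse_of_injective G.coordRep.toLinearMap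
    (LinearMap.ker_eq_bot.2 G.coordRep_injective)
  exact ⟨LinearMap.toContinuousLinearMap σ, fun x => LinearMap.congr_fun hσ x⟩

/-- The integrand of `mul` is the derivative of `repLog X (t • Y)`, so the integral telescopes
between `t = 0` and `t = 1`. -/
theorem coordRep_mul (x y : Fin n → ℝ) :
    G.coordRep (G.mul x y) = G.repLog (G.log x) (G.log y) := by
  obtain ⟨σ, hσ⟩ := G.exists_leftInverse_coordRep
  set X := G.log x
  set Y := G.log y
  set v : ℝ → Fin n → ℝ := fun t =>
    G.exp (G.bchKernel (G.expAd X * G.expAd (t • Y)) Y) with hv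
  have hd : ∀ t : ℝ, HasDerivAt (fun t : ℝ => G.repLog X (t • Y)) (G.coordRep (v t)) t := by
    intro t
    rw [coordRep_apply, hv, log_exp]
    exact G.hasDerivAt_repLog X Y t
  have hc : Continuous fun t => G.coordRep (v t) := by
    have h1 := (G.contDiff_repLog_smul (m := 1) X Y).continuous_deriv le_rfl
    rwa [funext fun t => (hd t).deriv] at h1
  have hvc : Continuous v := by
    have : v = fun t => σ (G.coordRep (v t)) := funext fun t => (hσ _).symm
    rw [this]
    exact σ.continuous.comp hc
  have hmul : G.mul x y = x + ∫ t in (0 : ℝ)..1, v t := rfl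
  rw [hmul, map_add, ← ContinuousLinearMap.intervalIntegral_comp_comm _
    (hvc.intervalIntegrable _ _),
    intervalIntegral.integral_eq_sub_of_hasDerivAt (fun t _ => hd t) (hc.intervalIntegrable _ _)]
  simp only [one_smul, zero_smul, repLog_zero_right, coordRep_apply]
  exact add_sub_cancel _ _

/-- The group embedded into the invertible operators. -/
def expRep (x : Fin n → ℝ) : ((Fin n → ℝ) × ℝ) →L[ℝ] ((Fin n → ℝ) × ℝ) :=
  NormedSpace.exp (G.coordRep x)

theorem expRep_mul (x y : Fin n → ℝ) : G.expRep (G.mul x y) = G.expRep x * G.expRep y := by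
  rw [expRep, coordRep_mul, exp_repLog]; rfl

/-- The truncated logarithm recovers the operator of `x` from its exponential. With `expRep_mul`,
identities in the group reduce to identities of operators. -/
theorem expRep_injective : Function.Injective G.expRep := by
  intro x y h
  refine G.coordRep_injective ?_
  rw [coordRep_apply, coordRep_apply, ← G.repLog_zero_right (G.log x),
    ← G.repLog_zero_right (G.log y), repLog, repLog]
  rw [expRep, expRep, coordRep_apply, coordRep_apply] at h
  rw [h]

theorem expRep_zero : G.expRep 0 = 1 := by rw [expRep, map_zero, NormedSpace.exp_zero]

theorem contDiff_mul_left (x : Fin n → ℝ) {m : WithTop ℕ∞} :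
    ContDiff ℝ m fun y => G.mul x y := by
  obtain ⟨σ, hσ⟩ := G.exists_leftInverse_coordRep
  have : (fun y => G.mul x y) = fun y => σ (G.repLog (G.log x) (G.log y)) :=
    funext fun y => by rw [← coordRep_mul, hσ]
  rw [this]
  refine σ.contDiff.comp (ContDiff.truncLog ?_ _)
  exact (contDiff_const.mul
    (G.contDiff_normedSpace_exp_rep G.basis.equivFun.symm.toLinearMap)).sub contDiff_const

/-! ### The group structure -/

theorem mul_assoc' (x y z : Fin n → ℝ) : G.mul (G.mul x y) z = G.mul x (G.mul y z) :=
  G.expRep_injective (by simp only [expRep_mul, mul_assoc])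

theorem mul_zero' (x : Fin n → ℝ) : G.mul x 0 = x :=
  G.expRep_injective (by rw [expRep_mul, expRep_zero, mul_one])

theorem zero_mul' (x : Fin n → ℝ) : G.mul 0 x = x :=
  G.expRep_injective (by rw [expRep_mul, expRep_zero, one_mul])

theorem mul_neg_self (x : Fin n → ℝ) : G.mul x (-x) = 0 :=
  G.expRep_injective (by
    rw [expRep_mul, expRep_zero, expRep, expRep, map_neg, normedSpace_exp_mul_exp_neg])

theorem neg_mul_self (x : Fin n → ℝ) : G.mul (-x) x = 0 :=
  G.expRep_injective (by
    rw [expRep_mul, expRep_zero, expRep, expRep, map_neg, normedSpace_exp_neg_mul_exp])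

theorem neg_mul_cancel_left' (x y : Fin n → ℝ) : G.mul (-x) (G.mul x y) = y := by
  rw [← mul_assoc', neg_mul_self, zero_mul']

theorem mul_neg_cancel_left' (x y : Fin n → ℝ) : G.mul x (G.mul (-x) y) = y := by
  rw [← mul_assoc', mul_neg_self, zero_mul']

theorem mul_exp_smul_exp_smul (E : 𝔤) (s t : ℝ) :
    G.mul (G.exp (s • E)) (G.exp (t • E)) = G.exp ((s + t) • E) := by
  refine G.expRep_injective ?_
  rw [expRep_mul]
  simp only [expRep, exp_smul, map_smul, add_smul, exp_add, map_add]
  exact (normedSpace_exp_add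
    (((Commute.refl (G.coordRep (G.exp E))).smul_left s).smul_right t)).symm

/-! ### Dilations as automorphisms -/

theorem dilation_one (x : Fin n → ℝ) : G.dilation 1 x = x := by
  ext j; simp [dilation]

theorem dilation_dilation (r s : ℝ) (x : Fin n → ℝ) :
    G.dilation r (G.dilation s x) = G.dilation (r * s) x := by
  ext j; simp [dilation, mul_pow, mul_assoc]

/-- The dilation as a linear map. -/
def dilationL (r : ℝ) : (Fin n → ℝ) →L[ℝ] (Fin n → ℝ) :=
  ContinuousLinearMap.pi fun j => (r ^ G.deg j) • ContinuousLinearMap.proj j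

theorem dilationL_apply (r : ℝ) (x : Fin n → ℝ) : G.dilationL r x = G.dilation r x := by
  ext j; simp [dilationL, dilation]

theorem log_dilation_of_mem_layer {d : ℕ} {v : 𝔤} (hv : v ∈ G.layer d) (r : ℝ) :
    G.log (G.dilation r (G.exp v)) = r ^ d • v := by
  refine G.basis.ext_elem fun j => ?_
  rw [repr_log, dilation, exp_apply]
  by_cases h : G.deg j = d
  · simp [h]
  · simp [G.repr_eq_zero_of_mem_layer hv h]

/-- The dilation of the Lie algebra. -/
def lieDilation (r : ℝ) : 𝔤 →ₗ[ℝ] 𝔤 :=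
  G.basis.equivFun.symm.toLinearMap ∘ₗ (G.dilationL r).toLinearMap ∘ₗ G.basis.equivFun.toLinearMap

theorem lieDilation_apply (r : ℝ) (v : 𝔤) : G.lieDilation r v = G.log (G.dilation r (G.exp v)) := by
  rw [← dilationL_apply]; rfl

theorem lieDilation_of_mem_layer {d : ℕ} {v : 𝔤} (hv : v ∈ G.layer d) (r : ℝ) :
    G.lieDilation r v = r ^ d • v := by
  rw [lieDilation_apply, G.log_dilation_of_mem_layer hv]

theorem lieDilation_lie (r : ℝ) (a b : 𝔤) :
    G.lieDilation r ⁅a, b⁆ = ⁅G.lieDilation r a, G.lieDilation r b⁆ := by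
  conv_lhs => rw [← G.basis.sum_repr a, ← G.basis.sum_repr b]
  conv_rhs => rw [← G.basis.sum_repr a, ← G.basis.sum_repr b]
  simp only [map_sum, sum_lie_sum]
  refine Finset.sum_congr rfl fun p _ => Finset.sum_congr rfl fun q _ => ?_
  simp only [smul_lie, lie_smul, map_smul,
    G.lieDilation_of_mem_layer (G.lie_mem_layer (G.basis_mem p) (G.basis_mem q)),
    G.lieDilation_of_mem_layer (G.basis_mem _)]
  module

theorem gradingDerivation_lieDilation (r : ℝ) (a : 𝔤) :
    G.gradingDerivation (G.lieDilation r a) = G.lieDilation r (G.gradingDerivation a) := by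
  refine G.basis.ext_elem fun j => ?_
  simp only [lieDilation_apply, repr_gradingDerivation, repr_log, dilation, exp_apply]
  ring

/-- The dilation of `𝔤 × ℝ` that is trivial on `ℝ`. -/
def extDilation (r : ℝ) : ((Fin n → ℝ) × ℝ) →L[ℝ] ((Fin n → ℝ) × ℝ) :=
  (G.dilationL r).prodMap (ContinuousLinearMap.id ℝ ℝ)

theorem extDilation_apply (r : ℝ) (w : (Fin n → ℝ) × ℝ) :
    G.extDilation r w = (G.dilation r w.1, w.2) :=
  Prod.ext (G.dilationL_apply r w.1) rfl

theorem coordRep_dilation_mul (r : ℝ) (x : Fin n → ℝ) :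
    G.coordRep (G.dilation r x) * G.extDilation r = G.extDilation r * G.coordRep x := by
  refine ContinuousLinearMap.ext fun w => ?_
  have h1 : G.log (G.dilation r x) = G.lieDilation r (G.log x) := by
    rw [lieDilation_apply, exp_log]
  have h2 : G.log (G.dilation r w.1) = G.lieDilation r (G.log w.1) := by
    rw [lieDilation_apply, exp_log]
  simp only [mul_apply_eq_comp, coordRep_apply, rep_apply, extDilation_apply]
  rw [h1, h2, ← lieDilation_lie, gradingDerivation_lieDilation, ← map_smul, ← map_sub,
    lieDilation_apply, exp_log]

theorem expRep_dilation_mul (r : ℝ) (x : Fin n → ℝ) :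
    G.expRep (G.dilation r x) * G.extDilation r = G.extDilation r * G.expRep x := by
  have h : ∀ k : ℕ, G.coordRep (G.dilation r x) ^ k * G.extDilation r
      = G.extDilation r * G.coordRep x ^ k :=
    fun k => (SemiconjBy.pow_right (G.coordRep_dilation_mul r x).symm k).symm
  simp only [expRep, coordRep_apply, exp_eq_truncExp (G.rep_pow _), truncExp, Finset.sum_mul,
    Finset.mul_sum, smul_mul_assoc, mul_smul_comm]
  simp only [← coordRep_apply, h]

theorem extDilation_mul_inv {r : ℝ} (hr : r ≠ 0) : G.extDilation r * G.extDilation r⁻¹ = 1 := by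
  refine ContinuousLinearMap.ext fun w => ?_
  simp only [mul_apply_eq_comp, extDilation_apply, dilation_dilation, mul_inv_cancel₀ hr, dilation_one]
  rfl

/-- In the representation the dilation is conjugation by `extDilation r`, which is multiplicative.
-/
theorem dilation_mul {r : ℝ} (hr : r ≠ 0) (x y : Fin n → ℝ) :
    G.dilation r (G.mul x y) = G.mul (G.dilation r x) (G.dilation r y) := by
  have key : ∀ z, G.expRep (G.dilation r z)
      = G.extDilation r * G.expRep z * G.extDilation r⁻¹ := by
    intro z
    rw [← expRep_dilation_mul, mul_assoc, extDilation_mul_inv _ hr, mul_one]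
  have hinv : G.extDilation r⁻¹ * G.extDilation r = 1 := by
    simpa using G.extDilation_mul_inv (inv_ne_zero hr)
  refine G.expRep_injective ?_
  rw [expRep_mul, key, key, key, expRep_mul]
  simp only [mul_assoc]
  rw [← mul_assoc (G.extDilation r⁻¹) (G.extDilation r), hinv, one_mul]

theorem dilation_exp {E : 𝔤} (hE : E ∈ G.layer 1) (r : ℝ) :
    G.dilation r (G.exp E) = G.exp (r • E) := by
  rw [← G.exp_log (G.dilation r (G.exp E)), G.log_dilation_of_mem_layer hE, pow_one]

/-! ### Additivity of the degree-one coordinates -/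

theorem truncExp_repEnd_mul (x y : Fin n → ℝ) :
    truncExp (G.step + 1) (G.repEnd (G.log (G.mul x y))) =
      truncExp (G.step + 1) (G.repEnd (G.log x)) * truncExp (G.step + 1) (G.repEnd (G.log y)) := by
  have := G.expRep_mul x y
  rw [expRep, expRep, expRep, coordRep_apply, coordRep_apply, coordRep_apply, normedSpace_exp_rep,
    normedSpace_exp_rep, normedSpace_exp_rep, ← map_mul] at this
  exact EquivLike.injective _ this

theorem apply_of_mem_raisingEnd_two {T : Module.End ℝ ((Fin n → ℝ) × ℝ)}
    (hT : T ∈ raisingEnd G.extFil 2) {j : Fin n} (hj : G.deg j = 1) : (T (0, 1)).1 j = 0 := by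
  have := (hT 0 (0, 1) (by simp [extFil_zero])).1 j (by omega)
  rwa [repr_log] at this

/-- The cross term `(S - 1)(T - 1)` raises the degree by two, so it is invisible in degree one. -/
theorem mul_sub_one_apply {S T : Module.End ℝ ((Fin n → ℝ) × ℝ)}
    (hS : S - 1 ∈ raisingEnd G.extFil 1) (hT : T - 1 ∈ raisingEnd G.extFil 1) {j : Fin n}
    (hj : G.deg j = 1) :
    ((S * T - 1) (0, 1)).1 j = ((S - 1) (0, 1)).1 j + ((T - 1) (0, 1)).1 j := by
  have hmem : (S - 1) * (T - 1) ∈ raisingEnd G.extFil 2 :=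
    raisingEnd_antitone G.extFil_antitone (by omega : 2 ≤ 1 + 1) (mul_mem_raisingEnd hS hT)
  have h0 := G.apply_of_mem_raisingEnd_two hmem hj
  rw [mul_sub_one_eq S T]
  change (((S - 1) * (T - 1)) (0, 1)).1 j + _ + _ = _
  rw [h0, zero_add]

theorem truncExp_repEnd_apply (x : Fin n → ℝ) {j : Fin n} (hj : G.deg j = 1) :
    ((truncExp (G.step + 1) (G.repEnd (G.log x)) - 1) (0, 1)).1 j = -x j := by
  have hstep : 1 ≤ G.step := hj ▸ G.deg_le_step j
  obtain ⟨s, hs⟩ : ∃ s, G.step + 1 = s + 2 := ⟨G.step - 1, by omega⟩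
  have h := G.apply_of_mem_raisingEnd_two (truncExp_sub_mem_raisingEnd G.extFil_antitone
    (G.repEnd_mem_raisingEnd (G.log x)) s) hj
  have hval : (G.repEnd (G.log x) (0, 1)).1 j = -x j := by
    rw [repEnd_apply]
    simp [log_zero, exp_apply, repr_gradingDerivation, hj, repr_log]
  rw [LinearMap.sub_apply, Prod.fst_sub, Pi.sub_apply, hval, sub_eq_zero] at h
  rw [hs, h]

/-- The coordinates of degree one are additive. -/
theorem mul_apply_of_deg_eq_one (x y : Fin n → ℝ) {j : Fin n} (hj : G.deg j = 1) :
    G.mul x y j = x j + y j := by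
  have h := G.truncExp_repEnd_apply (G.mul x y) hj
  rw [truncExp_repEnd_mul, G.mul_sub_one_apply
    (truncExp_sub_one_mem_raisingEnd G.extFil_antitone (G.repEnd_mem_raisingEnd _) _)
    (truncExp_sub_one_mem_raisingEnd G.extFil_antitone (G.repEnd_mem_raisingEnd _) _) hj,
    G.truncExp_repEnd_apply x hj, G.truncExp_repEnd_apply y hj] at h
  linarith

end

end CarnotGroup

/-! ### Absolutely continuous curves -/

section AbsolutelyContinuous

namespace AbsolutelyContinuousOnInterval

variable {X Y : Type*} [PseudoMetricSpace X] [PseudoMetricSpace Y] {f g : ℝ → X} {a b c : ℝ}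

theorem congr_of_eqOn (hf : AbsolutelyContinuousOnInterval f a b) (h : Set.EqOn f g (Set.uIcc a b)) :
    AbsolutelyContinuousOnInterval g a b := by
  rw [absolutelyContinuousOnInterval_iff] at hf ⊢
  intro ε hε
  obtain ⟨δ, hδ, H⟩ := hf ε hε
  refine ⟨δ, hδ, fun E hE hlt => ?_⟩
  convert H E hE hlt using 1
  exact Finset.sum_congr rfl fun i hi => by rw [h (hE.1 i hi).1, h (hE.1 i hi).2]

theorem lipschitzOnWith_comp (hf : AbsolutelyContinuousOnInterval f a b) {F : X → Y}
    {K : NNReal} {s : Set X} (hF : LipschitzOnWith K F s) (hs : Set.MapsTo f (Set.uIcc a b) s) :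
    AbsolutelyContinuousOnInterval (fun t => F (f t)) a b := by
  rw [absolutelyContinuousOnInterval_iff] at hf ⊢
  intro ε hε
  obtain ⟨δ, hδ, H⟩ := hf (ε / (K + 1)) (by positivity)
  refine ⟨δ, hδ, fun E hE hlt => ?_⟩
  calc ∑ i ∈ Finset.range E.1, dist (F (f (E.2 i).1)) (F (f (E.2 i).2))
      ≤ ∑ i ∈ Finset.range E.1, (K + 1) * dist (f (E.2 i).1) (f (E.2 i).2) := by
        refine Finset.sum_le_sum fun i hi => ?_
        refine (hF.dist_le_mul _ (hs (hE.1 i hi).1) _ (hs (hE.1 i hi).2)).trans ?_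
        gcongr
        simp
    _ = (K + 1) * ∑ i ∈ Finset.range E.1, dist (f (E.2 i).1) (f (E.2 i).2) := by
        rw [Finset.mul_sum]
    _ < (K + 1) * (ε / (K + 1)) := by
        gcongr
        exact H E hE hlt
    _ = ε := by field_simp

theorem comp_const_sub (hf : AbsolutelyContinuousOnInterval f a b) (c : ℝ) :
    AbsolutelyContinuousOnInterval (fun t => f (c - t)) (c - b) (c - a) := by
  rw [absolutelyContinuousOnInterval_iff] at hf ⊢
  intro ε hε
  obtain ⟨δ, hδ, H⟩ := hf ε hε
  refine ⟨δ, hδ, fun E hE hlt => ?_⟩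
  refine H (E.1, fun i => (c - (E.2 i).1, c - (E.2 i).2)) ⟨fun i hi => ?_, ?_⟩ ?_
  · obtain ⟨h1, h2⟩ := hE.1 i hi
    simp only [Set.mem_uIcc] at h1 h2 ⊢
    constructor <;> grind
  · intro i hi j hj hij
    have h := hE.2 hi hj hij
    simp only [Function.onFun, Set.disjoint_left, Set.mem_uIoc] at h ⊢
    intro x hx hx'
    -- Reflection turns half-open intervals around, so a common point `x` gives `c - x`, which may
    -- be a left endpoint. The smaller right endpoint `m` then lies in both original intervals.
    set m := min (max (E.2 i).1 (E.2 i).2) (max (E.2 j).1 (E.2 j).2) with hm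
    have := @h m
    grind
  · refine lt_of_le_of_lt (le_of_eq ?_) hlt
    exact Finset.sum_congr rfl fun i _ => dist_sub_left _ _ _

theorem concat (hf : AbsolutelyContinuousOnInterval f a b)
    (hf' : AbsolutelyContinuousOnInterval f b c) (hab : a ≤ b) (hbc : b ≤ c) :
    AbsolutelyContinuousOnInterval f a c := by
  rw [absolutelyContinuousOnInterval_iff] at hf hf' ⊢
  intro ε hε
  obtain ⟨δ, hδ, H⟩ := hf (ε / 2) (by positivity)
  obtain ⟨δ', hδ', H'⟩ := hf' (ε / 2) (by positivity)
  refine ⟨min δ δ', lt_min hδ hδ', fun E hE hlt => ?_⟩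
  -- Each interval is clipped to the two sides of `b`; clipping does not increase lengths and keeps
  -- disjointness.
  have h1 := H (E.1, fun i => (min (E.2 i).1 b, min (E.2 i).2 b)) ⟨fun i hi => ?_, ?_⟩ ?_
  have h2 := H' (E.1, fun i => (max (E.2 i).1 b, max (E.2 i).2 b)) ⟨fun i hi => ?_, ?_⟩ ?_
  · simp only at h1 h2
    calc ∑ i ∈ Finset.range E.1, dist (f (E.2 i).1) (f (E.2 i).2)
        ≤ ∑ i ∈ Finset.range E.1, (dist (f (min (E.2 i).1 b)) (f (min (E.2 i).2 b))
            + dist (f (max (E.2 i).1 b)) (f (max (E.2 i).2 b))) := by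
          refine Finset.sum_le_sum fun i _ => ?_
          rcases le_total (E.2 i).1 b with h | h <;> rcases le_total (E.2 i).2 b with h' | h'
          · simp [h, h']
          · simpa [h, h'] using dist_triangle _ _ _
          · simp only [h, h', min_eq_left, min_eq_right, max_eq_left, max_eq_right]
            rw [add_comm]
            exact dist_triangle _ _ _
          · simp [h, h']
      _ < ε := by rw [Finset.sum_add_distrib]; linarith
  · obtain ⟨h1, h2⟩ := hE.1 i hi
    simp only [Set.mem_uIcc] at h1 h2 ⊢
    constructor <;> grind
  · intro i hi j hj hij
    refine (hE.2 hi hj hij).mono ?_ ?_ <;>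
    · intro x hx
      simp only [Set.mem_uIoc] at hx ⊢
      grind
  · refine lt_of_le_of_lt (Finset.sum_le_sum fun i _ => ?_) (hlt.trans_le (min_le_right _ _))
    simp only [Real.dist_eq]
    exact abs_max_sub_max_le_abs _ _ _
  · obtain ⟨h1, h2⟩ := hE.1 i hi
    simp only [Set.mem_uIcc] at h1 h2 ⊢
    constructor <;> grind
  · intro i hi j hj hij
    refine (hE.2 hi hj hij).mono ?_ ?_ <;>
    · intro x hx
      simp only [Set.mem_uIoc] at hx ⊢
      grind
  · refine lt_of_le_of_lt (Finset.sum_le_sum fun i _ => ?_) (hlt.trans_le (min_le_left _ _))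
    simp only [Real.dist_eq]
    grind

end AbsolutelyContinuousOnInterval

end AbsolutelyContinuous

namespace CarnotGroup

noncomputable section

variable {𝔤 : Type*} [LieRing 𝔤] [LieAlgebra ℝ 𝔤] {n : ℕ} (G : CarnotGroup 𝔤 n)

/-! ### Left invariant vector fields -/

theorem hasDerivAt_mul_exp_smul (E : 𝔤) (x : Fin n → ℝ) :
    HasDerivAt (fun t : ℝ => G.mul x (G.exp (t • E))) (G.leftInvField E x) 0 := by
  have h : DifferentiableAt ℝ (fun t : ℝ => G.mul x (G.exp (t • E))) 0 := by
    simp only [exp_smul]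
    exact ((G.contDiff_mul_left x (m := 1)).differentiable one_ne_zero _).comp (0 : ℝ)
      (differentiableAt_id.smul_const _)
  exact h.hasDerivAt

theorem leftInvField_eq_fderiv (E : 𝔤) (x : Fin n → ℝ) :
    G.leftInvField E x = fderiv ℝ (fun y => G.mul x y) 0 (G.exp E) := by
  have h1 : HasDerivAt (fun t : ℝ => t • G.exp E) (G.exp E) 0 := by
    simpa using (hasDerivAt_id (0 : ℝ)).smul_const (G.exp E)
  have h2 : HasFDerivAt (fun y => G.mul x y) (fderiv ℝ (fun y => G.mul x y) 0)
      ((0 : ℝ) • G.exp E) := by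
    rw [zero_smul]
    exact ((G.contDiff_mul_left x (m := 1)).differentiable one_ne_zero _).hasFDerivAt
  have h3 := h2.comp_hasDerivAt (0 : ℝ) h1
  have h4 := G.hasDerivAt_mul_exp_smul E x
  simp only [exp_smul] at h4
  exact h4.unique h3

theorem hasDerivAt_mul_exp_smul_at (E : 𝔤) (x : Fin n → ℝ) (t : ℝ) :
    HasDerivAt (fun s : ℝ => G.mul x (G.exp (s • E)))
      (G.leftInvField E (G.mul x (G.exp (t • E)))) t := by
  have h := G.hasDerivAt_mul_exp_smul E (G.mul x (G.exp (t • E)))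
  rw [← sub_self t] at h
  have h' := h.comp_sub_const t t
  simpa only [mul_assoc', mul_exp_smul_exp_smul, add_sub_cancel] using h'

theorem sum_repr_horizontal {E : 𝔤} (hE : E ∈ G.layer 1) :
    ∑ j : G.HorIdx, G.basis.repr E j • G.basis j = E := by
  classical
  conv_rhs => rw [← G.basis.sum_repr E]
  rw [← Finset.sum_subtype (Finset.univ.filter fun j => G.deg j = 1) (by simp)
    (fun j => G.basis.repr E j • G.basis j)]
  refine Finset.sum_subset (Finset.filter_subset _ _) fun j _ hj => ?_
  rw [G.repr_eq_zero_of_mem_layer hE (by simpa using hj), zero_smul]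

theorem leftInvField_eq_sum {E : 𝔤} (hE : E ∈ G.layer 1) (x : Fin n → ℝ) :
    G.leftInvField E x = ∑ j : G.HorIdx, G.basis.repr E j • G.leftInvField (G.basis j) x := by
  have h : G.exp E = ∑ j : G.HorIdx, G.basis.repr E j • G.exp (G.basis j) := by
    conv_lhs => rw [← G.sum_repr_horizontal hE]
    simp only [exp, map_sum, map_smul]
  simp only [leftInvField_eq_fderiv]
  rw [h, map_sum]
  simp only [map_smul]

theorem leftInvField_apply_of_deg_eq_one (E : 𝔤) (x : Fin n → ℝ) {i : Fin n}
    (hi : G.deg i = 1) : G.leftInvField E x i = G.basis.repr E i := by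
  have h1 := hasDerivAt_pi.1 (G.hasDerivAt_mul_exp_smul E x) i
  have h2 : HasDerivAt (fun t : ℝ => G.mul x (G.exp (t • E)) i) (G.basis.repr E i) 0 := by
    simp only [G.mul_apply_of_deg_eq_one _ _ hi, exp_smul, Pi.smul_apply, smul_eq_mul, exp_apply]
    simpa using ((hasDerivAt_id (0 : ℝ)).mul_const (G.basis.repr E i)).const_add (x i)
  exact h1.unique h2

/-! ### Operations on horizontal curves -/

/-- `F` maps the left invariant field `X_j` to `c X_j` for `j ≤ r`. -/
def ScalesHorizontal (F : (Fin n → ℝ) → Fin n → ℝ) (c : ℝ) : Prop :=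
  ContDiff ℝ 1 F ∧ ∀ x (t : ℝ) (j : G.HorIdx),
    F (G.mul x (G.exp (t • G.basis j))) = G.mul (F x) (G.exp ((t * c) • G.basis j))

variable {G}

/-- Differentiates at `t = 0` the identity that describes how `F` moves the curve `x exp(tX_j)`. -/
theorem ScalesHorizontal.fderiv_leftInvField {F : (Fin n → ℝ) → Fin n → ℝ} {c : ℝ}
    (hF : G.ScalesHorizontal F c) (x : Fin n → ℝ) (j : G.HorIdx) :
    fderiv ℝ F x (G.leftInvField (G.basis j) x) = c • G.leftInvField (G.basis j) (F x) := by
  have h0 : G.mul x (G.exp ((0 : ℝ) • G.basis j)) = x := by rw [zero_smul, exp_zero, mul_zero']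
  have h1 : HasFDerivAt F (fderiv ℝ F x) (G.mul x (G.exp ((0 : ℝ) • G.basis j))) := by
    rw [h0]
    exact (hF.1.differentiable one_ne_zero x).hasFDerivAt
  have h2 := h1.comp_hasDerivAt (0 : ℝ) (G.hasDerivAt_mul_exp_smul (G.basis j) x)
  have h3 : HasDerivAt (fun t : ℝ => G.mul (F x) (G.exp ((t * c) • G.basis j)))
      (c • G.leftInvField (G.basis j) (F x)) 0 := by
    have h4 := G.hasDerivAt_mul_exp_smul (G.basis j) (F x)
    have h5 : HasDerivAt (fun t : ℝ => t * c) c 0 := by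
      simpa using (hasDerivAt_id (0 : ℝ)).mul_const c
    rw [← zero_mul c] at h4
    exact h4.scomp (0 : ℝ) h5
  have h6 : (F ∘ fun t : ℝ => G.mul x (G.exp (t • G.basis j)))
      = fun t : ℝ => G.mul (F x) (G.exp ((t * c) • G.basis j)) := funext fun t => hF.2 x t j
  rw [h6] at h2
  exact h2.unique h3

namespace IsHorizontalCurve

variable {γ : ℝ → Fin n → ℝ} {u : G.HorIdx → ℝ → ℝ} {a b : ℝ}

theorem ae_hasDerivAt (h : G.IsHorizontalCurve γ u a b) : ∀ᵐ t : ℝ, t ∈ Set.Icc a b →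
    HasDerivAt γ (∑ j : G.HorIdx, u j t • G.leftInvField (G.basis j) (γ t)) t :=
  (ae_restrict_iff' measurableSet_Icc).1 h.hasDerivAt

theorem map (h : G.IsHorizontalCurve γ u a b) {F : (Fin n → ℝ) → Fin n → ℝ} {c : ℝ}
    (hF : G.ScalesHorizontal F c) :
    G.IsHorizontalCurve (fun t => F (γ t)) (fun j t => c * u j t) a b where
  le := h.le
  absolutelyContinuous := by
    -- The curve stays in a ball, on which the `C¹` map `F` is Lipschitz.
    obtain ⟨R, hR⟩ := h.absolutelyContinuous.exists_bound
    obtain ⟨K, hK⟩ := hF.1.contDiffOn.exists_lipschitzOnWith one_ne_zero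
      (convex_closedBall (0 : Fin n → ℝ) R) (isCompact_closedBall _ _)
    exact h.absolutelyContinuous.lipschitzOnWith_comp hK fun t ht => by
      simpa using hR t ht
  integrable j := (h.integrable j).const_mul c
  hasDerivAt := by
    filter_upwards [h.hasDerivAt] with t ht
    have h1 := ((hF.1.differentiable one_ne_zero (γ t)).hasFDerivAt).comp_hasDerivAt t ht
    refine h1.congr_deriv ?_
    rw [map_sum]
    refine Finset.sum_congr rfl fun j _ => ?_
    rw [map_smul, hF.fderiv_leftInvField, smul_smul, mul_comm]

theorem reverse (h : G.IsHorizontalCurve γ u a b) (c : ℝ) :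
    G.IsHorizontalCurve (fun t => γ (c - t)) (fun j t => -u j (c - t)) (c - b) (c - a) where
  le := by linarith [h.le]
  absolutelyContinuous := h.absolutelyContinuous.comp_const_sub c
  integrable j := ((h.integrable j).comp_sub_left c).symm.neg
  hasDerivAt := by
    rw [ae_restrict_iff' measurableSet_Icc]
    have h1 := (Measure.measurePreserving_sub_left volume c).quasiMeasurePreserving.ae
      h.ae_hasDerivAt
    filter_upwards [h1] with t ht hmem
    refine ((ht ⟨by linarith [hmem.2], by linarith [hmem.1]⟩).comp_const_sub c t).congr_deriv ?_
    simp only [neg_smul, Finset.sum_neg_distrib]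

theorem shift (h : G.IsHorizontalCurve γ u a b) (c : ℝ) :
    G.IsHorizontalCurve (fun t => γ (t - c)) (fun j t => u j (t - c)) (a + c) (b + c) := by
  -- A translation of the parameter is a product of two reflections.
  have h1 := (h.reverse 0).reverse c
  have e : ∀ t, (0 : ℝ) - (c - t) = t - c := fun t => by ring
  simp only [e, neg_neg] at h1
  rwa [show c - (0 - a) = a + c by ring, show c - (0 - b) = b + c by ring] at h1

theorem concat {γ' : ℝ → Fin n → ℝ} {u' : G.HorIdx → ℝ → ℝ} {c : ℝ}
    (h : G.IsHorizontalCurve γ u a b) (h' : G.IsHorizontalCurve γ' u' b c) (hb : γ b = γ' b) :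
    G.IsHorizontalCurve (fun t => if t ≤ b then γ t else γ' t)
      (fun j t => if t ≤ b then u j t else u' j t) a c where
  le := h.le.trans h'.le
  absolutelyContinuous := by
    refine AbsolutelyContinuousOnInterval.concat (b := b) ?_ ?_ h.le h'.le
    · refine h.absolutelyContinuous.congr_of_eqOn fun t ht => ?_
      rw [Set.uIcc_of_le h.le] at ht
      simp [ht.2]
    · refine h'.absolutelyContinuous.congr_of_eqOn fun t ht => ?_
      rw [Set.uIcc_of_le h'.le] at ht
      rcases ht.1.eq_or_lt with rfl | hlt
      · simp [hb]
      · simp [hlt]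
  integrable j := by
    refine IntervalIntegrable.trans (b := b) ((h.integrable j).congr fun t ht => ?_)
      ((h'.integrable j).congr fun t ht => ?_)
    · rw [Set.uIoc_of_le h.le] at ht
      simp [ht.2]
    · rw [Set.uIoc_of_le h'.le] at ht
      simp [ht.1]
  hasDerivAt := by
    rw [ae_restrict_iff' measurableSet_Icc]
    have hne : ∀ᵐ t : ℝ, t ≠ b := by
      simp [ae_iff]
    filter_upwards [h.ae_hasDerivAt, h'.ae_hasDerivAt, hne] with t h1 h2 h3 hmem
    rcases lt_or_gt_of_ne h3 with hlt | hgt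
    · simp only [if_pos hlt.le]
      refine (h1 ⟨hmem.1, hlt.le⟩).congr_of_eventuallyEq ?_
      filter_upwards [Iio_mem_nhds hlt] with s hs
      simp [(show s < b from hs).le]
    · simp only [if_neg (not_le.2 hgt)]
      refine (h2 ⟨hgt.le, hmem.2⟩).congr_of_eventuallyEq ?_
      filter_upwards [Ioi_mem_nhds hgt] with s hs
      simp [show b < s from hs]

theorem intervalIntegrable_speed (h : G.IsHorizontalCurve γ u a b) :
    IntervalIntegrable (fun t => √(∑ j : G.HorIdx, (u j t) ^ 2)) volume a b := by
  have h1 : IntervalIntegrable (fun t => ∑ j : G.HorIdx, |u j t|) volume a b := by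
    simpa only [Finset.sum_fn] using IntervalIntegrable.sum Finset.univ
      fun j _ => (h.integrable j).abs
  refine h1.mono_fun ?_ (ae_of_all _ fun t => ?_)
  · refine Real.continuous_sqrt.comp_aestronglyMeasurable ?_
    refine Finset.aestronglyMeasurable_fun_sum _ fun j _ => ?_
    exact (h.integrable j).def'.aestronglyMeasurable.pow 2
  · beta_reduce
    rw [Real.norm_of_nonneg (Real.sqrt_nonneg _),
      Real.norm_of_nonneg (Finset.sum_nonneg fun j _ => abs_nonneg _)]
    refine Real.sqrt_le_iff.2 ⟨Finset.sum_nonneg fun j _ => abs_nonneg _, ?_⟩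
    have := Finset.sum_sq_le_sq_sum_of_nonneg (s := Finset.univ) (f := fun j => |u j t|)
      fun j _ => abs_nonneg _
    simpa [sq_abs] using this

end IsHorizontalCurve

/-! ### Lengths and the horizontal inner product -/

variable (G)

theorem length_const_mul {c : ℝ} (hc : 0 ≤ c) (u : G.HorIdx → ℝ → ℝ) (a b : ℝ) :
    G.length (fun j t => c * u j t) a b = c * G.length u a b := by
  rw [length, length, ← intervalIntegral.integral_const_mul]
  refine intervalIntegral.integral_congr fun t _ => ?_
  simp only [mul_pow, ← Finset.mul_sum]
  rw [Real.sqrt_mul (sq_nonneg c), Real.sqrt_sq hc]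

theorem length_reverse (u : G.HorIdx → ℝ → ℝ) (a b c : ℝ) :
    G.length (fun j t => -u j (c - t)) (c - b) (c - a) = G.length u a b := by
  rw [length, length]
  simp only [neg_sq]
  rw [intervalIntegral.integral_comp_sub_left (fun t => √(∑ j : G.HorIdx, (u j t) ^ 2)) c,
    sub_sub_cancel, sub_sub_cancel]

theorem length_shift (u : G.HorIdx → ℝ → ℝ) (a b c : ℝ) :
    G.length (fun j t => u j (t - c)) (a + c) (b + c) = G.length u a b := by
  rw [length, length,
    intervalIntegral.integral_comp_sub_right (fun t => √(∑ j : G.HorIdx, (u j t) ^ 2)) c,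
    add_sub_cancel_right, add_sub_cancel_right]

theorem length_nonneg {u : G.HorIdx → ℝ → ℝ} {a b : ℝ} (h : a ≤ b) : 0 ≤ G.length u a b :=
  intervalIntegral.integral_nonneg h fun _ _ => Real.sqrt_nonneg _

theorem length_concat {γ γ' : ℝ → Fin n → ℝ} {u u' : G.HorIdx → ℝ → ℝ} {a b c : ℝ}
    (h : G.IsHorizontalCurve γ u a b) (h' : G.IsHorizontalCurve γ' u' b c) :
    G.length (fun j t => if t ≤ b then u j t else u' j t) a c
      = G.length u a b + G.length u' b c := by
  have e1 : Set.EqOn (fun t => √(∑ j : G.HorIdx, (u j t) ^ 2))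
      (fun t => √(∑ j : G.HorIdx, (if t ≤ b then u j t else u' j t) ^ 2)) (Set.uIoc a b) := by
    intro t ht
    rw [Set.uIoc_of_le h.le] at ht
    simp [ht.2]
  have e2 : Set.EqOn (fun t => √(∑ j : G.HorIdx, (u' j t) ^ 2))
      (fun t => √(∑ j : G.HorIdx, (if t ≤ b then u j t else u' j t) ^ 2)) (Set.uIoc b c) := by
    intro t ht
    rw [Set.uIoc_of_le h'.le] at ht
    simp only [if_neg (not_le.2 ht.1)]
  rw [length, length, length, ← intervalIntegral.integral_add_adjacent_intervals
    (h.intervalIntegrable_speed.congr e1) (h'.intervalIntegrable_speed.congr e2),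
    intervalIntegral.integral_congr_ae (ae_of_all _ fun t ht => e1 ht),
    intervalIntegral.integral_congr_ae (ae_of_all _ fun t ht => e2 ht)]

/-- The inner product of the horizontal components. -/
def horInner (E : 𝔤) (v : Fin n → ℝ) : ℝ := ∑ j : G.HorIdx, G.basis.repr E j * v j

theorem horInner_mul (E : 𝔤) (x y : Fin n → ℝ) :
    G.horInner E (G.mul x y) = G.horInner E x + G.horInner E y := by
  simp only [horInner, ← Finset.sum_add_distrib, ← mul_add]
  exact Finset.sum_congr rfl fun j _ => by rw [G.mul_apply_of_deg_eq_one x y j.2]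

theorem horInner_dilation (E : 𝔤) (r : ℝ) (x : Fin n → ℝ) :
    G.horInner E (G.dilation r x) = r * G.horInner E x := by
  simp only [horInner, Finset.mul_sum, dilation]
  exact Finset.sum_congr rfl fun j _ => by rw [j.2, pow_one]; ring

theorem horInner_zero (E : 𝔤) : G.horInner E 0 = 0 := by simp [horInner]

theorem horInner_neg (E : 𝔤) (x : Fin n → ℝ) : G.horInner E (-x) = -G.horInner E x := by
  simp [horInner]

theorem horInner_neg_left (E : 𝔤) (x : Fin n → ℝ) : G.horInner (-E) x = -G.horInner E x := by
  simp [horInner]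

theorem omega_nonneg (E : 𝔤) : 0 ≤ G.omega E := Real.sqrt_nonneg _

theorem horInner_exp_self (E : 𝔤) : G.horInner E (G.exp E) = G.omega E ^ 2 := by
  rw [omega, Real.sq_sqrt (Finset.sum_nonneg fun j _ => sq_nonneg _), horInner]
  exact Finset.sum_congr rfl fun j _ => by rw [exp_apply, sq]

theorem omega_smul (c : ℝ) (E : 𝔤) : G.omega (c • E) = |c| * G.omega E := by
  simp only [omega, map_smul, Finsupp.smul_apply, smul_eq_mul, mul_pow, ← Finset.mul_sum]
  rw [Real.sqrt_mul (sq_nonneg c), Real.sqrt_sq_eq_abs]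

theorem omega_neg (E : 𝔤) : G.omega (-E) = G.omega E := by
  simp [omega]

theorem omega_pos {E : 𝔤} (hE : E ∈ G.layer 1) (h0 : E ≠ 0) : 0 < G.omega E := by
  refine (G.omega_nonneg E).lt_of_ne fun h => h0 ?_
  have h1 := (Real.sqrt_eq_zero (Finset.sum_nonneg fun j _ => sq_nonneg _)).1 h.symm
  rw [Finset.sum_eq_zero_iff_of_nonneg fun j _ => sq_nonneg _] at h1
  rw [← G.sum_repr_horizontal hE]
  refine Finset.sum_eq_zero fun j hj => ?_
  have := h1 j hj
  rw [pow_eq_zero_iff two_ne_zero] at this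
  rw [this, zero_smul]

/-- The degree-one coordinates of a horizontal curve have derivative `u`, so this is Cauchy-Schwarz
under the integral. It supplies the lower bounds for the distance. -/
theorem horInner_sub_le_length {E : 𝔤} (hE : G.omega E ≤ 1) {γ : ℝ → Fin n → ℝ}
    {u : G.HorIdx → ℝ → ℝ} {a b : ℝ} (h : G.IsHorizontalCurve γ u a b) :
    G.horInner E (γ b) - G.horInner E (γ a) ≤ G.length u a b := by
  set L : (Fin n → ℝ) →L[ℝ] ℝ :=
    ∑ j : G.HorIdx, G.basis.repr E j • ContinuousLinearMap.proj (R := ℝ) (j : Fin n) with hL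
  have hLv : ∀ v, L v = G.horInner E v := fun v => by
    simp [hL, horInner]
  have hac : AbsolutelyContinuousOnInterval (fun t => L (γ t)) a b :=
    h.absolutelyContinuous.lipschitzOnWith_comp (L.lipschitz.lipschitzOnWith (s := Set.univ))
      fun _ _ => Set.mem_univ _
  rw [← hLv, ← hLv, ← hac.integral_deriv_eq_sub]
  refine intervalIntegral.integral_mono_ae_restrict h.le hac.intervalIntegrable_deriv
    h.intervalIntegrable_speed ?_
  filter_upwards [h.hasDerivAt] with t ht
  have hd : deriv (fun t => L (γ t)) t = L _ := (L.hasFDerivAt.comp_hasDerivAt t ht).deriv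
  rw [hd, hLv]
  have h1 : ∀ i : G.HorIdx,
      (∑ j : G.HorIdx, u j t • G.leftInvField (G.basis j) (γ t)) (i : Fin n) = u i t := by
    intro i
    rw [Finset.sum_apply, Finset.sum_eq_single i]
    · simp [G.leftInvField_apply_of_deg_eq_one _ _ i.2]
    · intro j _ hji
      have : (j : Fin n) ≠ i := fun h => hji (Subtype.ext h)
      simp [G.leftInvField_apply_of_deg_eq_one _ _ i.2, this]
    · simp
  simp only [horInner, h1]
  refine (Real.sum_mul_le_sqrt_mul_sqrt _ _ _).trans ?_
  exact mul_le_of_le_one_left (Real.sqrt_nonneg _) hE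

end

end CarnotGroup

namespace CarnotGroup

noncomputable section

variable {𝔤 : Type*} [LieRing 𝔤] [LieAlgebra ℝ 𝔤] {n : ℕ} (G : CarnotGroup 𝔤 n)

/-! ### The Carnot-Carathéodory distance -/

variable {G} in
theorem IsHorizontalCurve.dist_le {γ : ℝ → Fin n → ℝ} {u : G.HorIdx → ℝ → ℝ} {a b : ℝ}
    (h : G.IsHorizontalCurve γ u a b) :
    G.dist (γ a) (γ b) ≤ ENNReal.ofReal (G.length u a b) :=
  sInf_le ⟨a, b, γ, u, h, rfl, rfl, rfl⟩

theorem le_dist {x y : Fin n → ℝ} {C : ℝ≥0∞}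
    (h : ∀ (a b : ℝ) (γ : ℝ → Fin n → ℝ) (u : G.HorIdx → ℝ → ℝ), G.IsHorizontalCurve γ u a b →
      γ a = x → γ b = y → C ≤ ENNReal.ofReal (G.length u a b)) : C ≤ G.dist x y := by
  refine le_sInf ?_
  rintro _ ⟨a, b, γ, u, hγ, ha, hb, rfl⟩
  exact h a b γ u hγ ha hb

theorem dist_comm' (x y : Fin n → ℝ) : G.dist x y = G.dist y x := by
  have key : ∀ x y, G.dist x y ≤ G.dist y x := by
    intro x y
    refine G.le_dist fun a b γ u hγ ha hb => ?_
    have := (hγ.reverse 0).dist_le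
    rwa [length_reverse, sub_sub_cancel, sub_sub_cancel, ha, hb] at this
  exact le_antisymm (key x y) (key y x)

theorem dist_triangle' (x y z : Fin n → ℝ) : G.dist x z ≤ G.dist x y + G.dist y z := by
  -- Truncated subtraction allows the two infima to be taken one after the other.
  have h1 : ∀ (a b : ℝ) (γ : ℝ → Fin n → ℝ) (u : G.HorIdx → ℝ → ℝ),
      G.IsHorizontalCurve γ u a b → γ a = x → γ b = y →
      G.dist x z - ENNReal.ofReal (G.length u a b) ≤ G.dist y z := by
    intro a b γ u hγ ha hb
    refine G.le_dist fun a' b' γ' u' hγ' ha' hb' => ?_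
    rw [tsub_le_iff_left, ← ENNReal.ofReal_add (G.length_nonneg hγ.le) (G.length_nonneg hγ'.le)]
    have hs := hγ'.shift (b - a')
    rw [add_sub_cancel] at hs
    have hc := hγ.concat hs (by rw [sub_sub_cancel, hb, ha'])
    have hd := hc.dist_le
    have hl := G.length_shift u' a' b' (b - a')
    rw [add_sub_cancel] at hl
    rw [G.length_concat hγ hs, hl] at hd
    have e1 : (if a ≤ b then γ a else γ' (a - (b - a'))) = x := by rw [if_pos hγ.le, ha]
    have e2 : (if b' + (b - a') ≤ b then γ (b' + (b - a'))
        else γ' (b' + (b - a') - (b - a'))) = z := by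
      -- The first branch occurs only if the second curve has a one-point parameter interval, and
      -- then `y = z`.
      split_ifs with h
      · have hb'' : b' = a' := le_antisymm (by linarith) hγ'.le
        rw [hb'', add_sub_cancel, hb, ← ha', ← hb'', hb']
      · rw [add_sub_cancel_right, hb']
    rwa [e1, e2] at hd
  rw [add_comm, ← tsub_le_iff_left]
  refine G.le_dist fun a b γ u hγ ha hb => ?_
  rw [tsub_le_iff_left, add_comm, ← tsub_le_iff_left, tsub_le_iff_left]
  exact tsub_le_iff_left.1 (h1 a b γ u hγ ha hb)

/-- Used for left translations (`c = 1`) and dilations (`c = r`); the inverse map then gives the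
reverse inequality. -/
theorem dist_map_le {F : (Fin n → ℝ) → Fin n → ℝ} {c : ℝ} (hF : G.ScalesHorizontal F c)
    (hc : 0 < c) (x y : Fin n → ℝ) : G.dist (F x) (F y) ≤ ENNReal.ofReal c * G.dist x y := by
  rw [← ENNReal.inv_mul_le_iff (by simpa using hc) ENNReal.ofReal_ne_top]
  refine G.le_dist fun a b γ u hγ ha hb => ?_
  rw [ENNReal.inv_mul_le_iff (by simpa using hc) ENNReal.ofReal_ne_top,
    ← ENNReal.ofReal_mul hc.le, ← G.length_const_mul hc.le, ← ha, ← hb]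
  exact (hγ.map hF).dist_le

theorem scalesHorizontal_mul (g : Fin n → ℝ) : G.ScalesHorizontal (fun y => G.mul g y) 1 :=
  ⟨G.contDiff_mul_left g, fun x t j => by rw [mul_one, mul_assoc']⟩

theorem scalesHorizontal_dilation {r : ℝ} (hr : r ≠ 0) : G.ScalesHorizontal (G.dilation r) r := by
  refine ⟨?_, fun x t j => ?_⟩
  · exact (funext (G.dilationL_apply r) : ⇑(G.dilationL r) = G.dilation r) ▸
      (G.dilationL r).contDiff
  · have hj : t • G.basis j ∈ G.layer 1 := Submodule.smul_mem _ _ (by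
      have := G.basis_mem j
      rwa [j.2] at this)
    rw [G.dilation_mul hr, G.dilation_exp hj, smul_smul, mul_comm]

theorem dist_mul_left (g x y : Fin n → ℝ) : G.dist (G.mul g x) (G.mul g y) = G.dist x y := by
  have key : ∀ g x y, G.dist (G.mul g x) (G.mul g y) ≤ G.dist x y := fun g x y => by
    simpa using G.dist_map_le (G.scalesHorizontal_mul g) one_pos x y
  refine le_antisymm (key g x y) ?_
  simpa [neg_mul_cancel_left'] using key (-g) (G.mul g x) (G.mul g y)

theorem dist_dilation {r : ℝ} (hr : 0 < r) (x y : Fin n → ℝ) :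
    G.dist (G.dilation r x) (G.dilation r y) = ENNReal.ofReal r * G.dist x y := by
  refine le_antisymm (G.dist_map_le (G.scalesHorizontal_dilation hr.ne') hr x y) ?_
  have h := G.dist_map_le (G.scalesHorizontal_dilation (inv_pos.2 hr).ne') (inv_pos.2 hr)
    (G.dilation r x) (G.dilation r y)
  rw [dilation_dilation, dilation_dilation, inv_mul_cancel₀ hr.ne', dilation_one,
    dilation_one, ENNReal.ofReal_inv_of_pos hr] at h
  rwa [← ENNReal.inv_mul_le_iff (ENNReal.inv_ne_zero.2 ENNReal.ofReal_ne_top)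
    (ENNReal.inv_ne_top.2 (by simpa using hr)), inv_inv] at h

theorem dist_mul_exp_le {E : 𝔤} (hE : E ∈ G.layer 1) (x : Fin n → ℝ) :
    G.dist x (G.mul x (G.exp E)) ≤ ENNReal.ofReal (G.omega E) := by
  have hd : ∀ t : ℝ, HasDerivAt (fun t : ℝ => G.mul x (G.exp (t • E)))
      (∑ j : G.HorIdx, G.basis.repr E j • G.leftInvField (G.basis j) (G.mul x (G.exp (t • E)))) t :=
    fun t => by rw [← G.leftInvField_eq_sum hE]; exact G.hasDerivAt_mul_exp_smul_at E x t
  have hγ : G.IsHorizontalCurve (fun t : ℝ => G.mul x (G.exp (t • E)))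
      (fun j _ => G.basis.repr E j) 0 1 := by
    refine ⟨zero_le_one, ?_, fun j => intervalIntegrable_const, ae_of_all _ hd⟩
    refine ContDiffOn.absolutelyContinuousOnInterval (ContDiff.contDiffOn ?_)
    simp only [exp_smul]
    exact (G.contDiff_mul_left x).comp (contDiff_id.smul contDiff_const)
  have := hγ.dist_le
  simpa [length, exp_zero, mul_zero', omega] using this

theorem horInner_sub_le_dist {E : 𝔤} (hE : G.omega E ≤ 1) (x y : Fin n → ℝ) :
    ENNReal.ofReal (G.horInner E y - G.horInner E x) ≤ G.dist x y := by
  refine G.le_dist fun a b γ u hγ ha hb => ENNReal.ofReal_le_ofReal ?_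
  rw [← ha, ← hb]
  exact G.horInner_sub_le_length hE hγ

theorem horInner_le_toReal_dist {E : 𝔤} (hE : G.omega E ≤ 1) {y : Fin n → ℝ}
    (hy : G.dist 0 y ≠ ⊤) : G.horInner E y ≤ (G.dist 0 y).toReal := by
  have := G.horInner_sub_le_dist hE 0 y
  rw [horInner_zero, sub_zero] at this
  exact ENNReal.ofReal_le_iff_le_toReal hy |>.1 this

theorem distZero_eq (y : Fin n → ℝ) : G.distZero y = (G.dist 0 y).toReal := by
  rw [distZero, dist_comm']

/-- Horizontal segments are geodesics: the segment gives the upper bound, and projection onto the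
direction of `E` the lower one. -/
theorem dist_exp {E : 𝔤} (hE : E ∈ G.layer 1) :
    G.dist 0 (G.exp E) = ENNReal.ofReal (G.omega E) := by
  refine le_antisymm (by simpa [zero_mul'] using G.dist_mul_exp_le hE 0) ?_
  rcases (G.omega_nonneg E).eq_or_lt with h0 | h0
  · simp [← h0]
  have hle : G.omega ((G.omega E)⁻¹ • E) ≤ 1 := by
    rw [omega_smul, abs_of_pos (inv_pos.2 h0), inv_mul_cancel₀ h0.ne']
  have h1 := G.horInner_sub_le_dist hle 0 (G.exp E)
  have h2 : G.horInner ((G.omega E)⁻¹ • E) (G.exp E) = G.omega E := by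
    have : G.horInner ((G.omega E)⁻¹ • E) (G.exp E) = (G.omega E)⁻¹ * G.horInner E (G.exp E) := by
      simp [horInner, Finset.mul_sum, mul_assoc]
    rw [this, horInner_exp_self, sq, ← mul_assoc, inv_mul_cancel₀ h0.ne', one_mul]
  rwa [h2, horInner_zero, sub_zero] at h1

theorem distZero_exp {E : 𝔤} (hE : E ∈ G.layer 1) : G.distZero (G.exp E) = G.omega E := by
  rw [distZero_eq, dist_exp _ hE, ENNReal.toReal_ofReal (G.omega_nonneg E)]

theorem dist_mul_exp_ne_top {E : 𝔤} (hE : E ∈ G.layer 1) {v : Fin n → ℝ} (hv : G.dist 0 v ≠ ⊤) :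
    G.dist 0 (G.mul (G.exp E) v) ≠ ⊤ := by
  refine ne_top_of_le_ne_top ?_ (G.dist_triangle' 0 (G.exp E) _)
  refine ENNReal.add_ne_top.2 ⟨by simp [dist_exp _ hE], ?_⟩
  have := G.dist_mul_left (G.exp E) 0 v
  rw [mul_zero'] at this
  rwa [this]

theorem isLipschitzConstant_distZero : G.IsLipschitzConstant G.distZero 1 := by
  refine ⟨zero_le_one, fun x y => ?_⟩
  rw [ENNReal.ofReal_one, one_mul]
  by_cases hxy : G.dist x y = ⊤
  · simp [hxy]
  have h1 := G.dist_triangle' x y 0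
  have h2 := G.dist_triangle' y x 0
  rw [G.dist_comm' y x] at h2
  rw [distZero, distZero, ENNReal.ofReal_le_iff_le_toReal hxy]
  -- At finite mutual distance, `x` and `y` are both infinitely far from 0 or both not. In the first
  -- case `distZero` takes the default value 0 at both.
  by_cases hx : G.dist x 0 = ⊤
  · have hy : G.dist y 0 = ⊤ := by
      by_contra hy
      exact absurd (top_le_iff.1 (hx ▸ h1)) (ENNReal.add_ne_top.2 ⟨hxy, hy⟩)
    simp [hx, hy]
  have hy : G.dist y 0 ≠ ⊤ := ne_top_of_le_ne_top (ENNReal.add_ne_top.2 ⟨hxy, hx⟩) h2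
  have h1' := ENNReal.toReal_mono (ENNReal.add_ne_top.2 ⟨hxy, hy⟩) h1
  have h2' := ENNReal.toReal_mono (ENNReal.add_ne_top.2 ⟨hxy, hx⟩) h2
  rw [ENNReal.toReal_add hxy hy] at h1'
  rw [ENNReal.toReal_add hxy hx] at h2'
  rw [abs_le]
  constructor <;> linarith

theorem lip_distZero {E : 𝔤} (hE : E ∈ G.layer 1) (h1 : G.omega E = 1) :
    G.lip G.distZero = 1 := by
  refine le_antisymm (csInf_le ⟨0, fun C hC => hC.1⟩ G.isLipschitzConstant_distZero) ?_
  refine le_csInf ⟨1, G.isLipschitzConstant_distZero⟩ fun C hC => ?_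
  have h0 : G.distZero 0 = 0 := by
    rw [← G.exp_zero, G.distZero_exp (Submodule.zero_mem _)]
    simp [omega]
  have := hC.2 0 (G.exp E)
  rw [h0, G.distZero_exp hE, G.dist_exp hE, h1, ← ENNReal.ofReal_mul hC.1, mul_one] at this
  simpa using (ENNReal.ofReal_le_ofReal_iff hC.1).1 this

theorem abs_sub_le_lip {f : (Fin n → ℝ) → ℝ} (hf : G.IsLipschitz f) {x y : Fin n → ℝ}
    (h : G.dist x y ≠ ⊤) : |f x - f y| ≤ G.lip f * (G.dist x y).toReal := by
  set d := (G.dist x y).toReal with hd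
  have hd0 : 0 ≤ d := ENNReal.toReal_nonneg
  refine le_of_forall_pos_le_add fun ε hε => ?_
  obtain ⟨C, hC, hlt⟩ := exists_lt_of_csInf_lt (s := {C | G.IsLipschitzConstant f C}) hf
    (lt_add_of_pos_right (G.lip f) (div_pos hε (by positivity : 0 < d + 1)))
  have h1 := hC.2 x y
  rw [← ENNReal.ofReal_toReal h, ← ENNReal.ofReal_mul hC.1,
    ENNReal.ofReal_le_ofReal_iff (mul_nonneg hC.1 hd0)] at h1
  calc |f x - f y| ≤ C * d := h1
    _ ≤ (G.lip f + ε / (d + 1)) * d := by gcongr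
    _ = G.lip f * d + ε * (d / (d + 1)) := by ring
    _ ≤ G.lip f * d + ε := by
      gcongr
      exact mul_le_of_le_one_right hε.le ((div_le_one (by positivity)).2 (by linarith))

theorem lip_nonneg (f : (Fin n → ℝ) → ℝ) : 0 ≤ G.lip f :=
  Real.sInf_nonneg fun _ hC => hC.1

/-! ### Pansu differentiability -/

theorem isLittleO_dist_iff (g : (Fin n → ℝ) → ℝ) (x : Fin n → ℝ) :
    (g =o[comap (fun y => G.dist x y) (𝓝 0)] fun y => (G.dist x y).toReal) ↔
      ∀ ε > 0, ∃ η > 0, ∀ y, G.dist x y ≤ ENNReal.ofReal η →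
        |g y| ≤ ε * (G.dist x y).toReal := by
  rw [Asymptotics.isLittleO_iff]
  refine forall₂_congr fun ε _ => ?_
  rw [(ENNReal.nhds_zero_basis_Iic.comap _).eventually_iff]
  simp only [Real.norm_eq_abs, abs_of_nonneg ENNReal.toReal_nonneg, Set.mem_preimage, Set.mem_Iic]
  constructor
  · rintro ⟨a, ha, h⟩
    refine ⟨(min a 1).toReal, ENNReal.toReal_pos (by simp [ha.ne']) (by simp), fun y hy => h ?_⟩
    rw [ENNReal.ofReal_toReal (by simp)] at hy
    exact hy.trans (min_le_left _ _)
  · rintro ⟨η, hη, h⟩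
    exact ⟨ENNReal.ofReal η, by simpa using hη, fun y hy => h y hy⟩

variable {G} in
theorem IsGLinear.map_neg {L : (Fin n → ℝ) → ℝ} (hL : G.IsGLinear L) (x : Fin n → ℝ) :
    L (-x) = -L x := by
  have h0 : L 0 = 0 := by
    have := hL.1 0 0
    rw [mul_zero'] at this
    linarith
  have := hL.1 x (-x)
  rw [mul_neg_self, h0] at this
  linarith

theorem dist_zero_neg (w : Fin n → ℝ) : G.dist 0 (-w) = G.dist 0 w := by
  have := G.dist_mul_left w 0 (-w)
  rw [mul_zero', mul_neg_self, dist_comm'] at this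
  exact this.symm

theorem dist_zero_dilation {r : ℝ} (hr : 0 < r) (w : Fin n → ℝ) :
    G.dist 0 (G.dilation r w) = ENNReal.ofReal r * G.dist 0 w := by
  have h : G.dilation r 0 = 0 := by ext j; simp [dilation]
  have := G.dist_dilation hr 0 w
  rwa [h] at this

theorem isGLinear_horInner (c : ℝ) (E : 𝔤) : G.IsGLinear fun v => c * G.horInner E v :=
  ⟨fun x y => by beta_reduce; rw [horInner_mul, mul_add],
    fun r _ x => by beta_reduce; rw [horInner_dilation]; ring⟩

/-- The Pansu differential of the distance at a horizontal point. -/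
theorem distZero_mul_exp_approx (hD : G.DistDifferentiableInHorizontalDirections) {E : 𝔤}
    (hE : E ∈ G.layer 1) (h1 : G.omega E = 1) {ε : ℝ} (hε : 0 < ε) :
    ∃ η > 0, ∀ v, G.dist 0 v ≤ ENNReal.ofReal η →
      |G.distZero (G.mul (G.exp E) v) - 1 - G.horInner E v| ≤ ε * (G.dist 0 v).toReal := by
  have hE0 : E ≠ 0 := by
    rintro rfl
    simp [omega] at h1
  obtain ⟨L, hL, ho⟩ := hD E hE hE0
  rw [isLittleO_dist_iff] at ho
  have ho' : ∀ ε > 0, ∃ η > 0, ∀ v, G.dist 0 v ≤ ENNReal.ofReal η →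
      |G.distZero (G.mul (G.exp E) v) - 1 - L v| ≤ ε * (G.dist 0 v).toReal := by
    intro ε hε
    obtain ⟨η, hη, h⟩ := ho ε hε
    refine ⟨η, hη, fun v hv => ?_⟩
    have e : G.dist (G.exp E) (G.mul (G.exp E) v) = G.dist 0 v := by
      have := G.dist_mul_left (G.exp E) 0 v
      rwa [mul_zero'] at this
    have := h (G.mul (G.exp E) v) (e.symm ▸ hv)
    rwa [neg_mul_cancel_left', e, distZero_exp _ hE, h1] at this
  -- The bound `d(exp(E) v) ≥ 1 + ⟨E, v⟩` is applied to `v = δ_s w`. Both sides are homogeneous in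
  -- `s`, so the inequality between differentials survives division by `s`.
  have hle : ∀ w, G.dist 0 w ≠ ⊤ → G.horInner E w ≤ L w := by
    intro w hw
    set d := (G.dist 0 w).toReal with hd
    have hd0 : 0 ≤ d := ENNReal.toReal_nonneg
    refine le_of_forall_pos_le_add fun ε hε => ?_
    obtain ⟨η, hη, h⟩ := ho' (ε / (d + 1)) (by positivity)
    -- This brings `δ_s w` within distance `η`; the `+ 1` covers `d = 0`.
    set s := η / (d + 1) with hs
    have hs0 : 0 < s := by positivity
    have hds : G.dist 0 (G.dilation s w) = ENNReal.ofReal (s * d) := by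
      rw [dist_zero_dilation _ hs0, ENNReal.ofReal_mul hs0.le, ENNReal.ofReal_toReal hw]
    have hfrac : d / (d + 1) ≤ 1 := (div_le_one (by positivity)).2 (by linarith)
    have h2 := h (G.dilation s w) (by
      rw [hds]
      refine ENNReal.ofReal_le_ofReal ?_
      calc s * d = η * (d / (d + 1)) := by rw [hs]; ring
        _ ≤ η := mul_le_of_le_one_right hη.le hfrac)
    rw [hds, ENNReal.toReal_ofReal (by positivity), hL.2 s hs0] at h2
    have h3 := G.horInner_le_toReal_dist h1.le
      (G.dist_mul_exp_ne_top hE (v := G.dilation s w) (by simp [hds]))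
    rw [← distZero_eq, horInner_mul, horInner_exp_self, h1, horInner_dilation] at h3
    have h4 := (abs_le.1 h2).2
    have h5 : s * G.horInner E w ≤ s * (L w + ε) := by
      have : ε / (d + 1) * (s * d) ≤ s * ε := by
        calc ε / (d + 1) * (s * d) = s * ε * (d / (d + 1)) := by ring
          _ ≤ s * ε := mul_le_of_le_one_right (by positivity) hfrac
      linarith
    exact le_of_mul_le_mul_left h5 hs0
  obtain ⟨η, hη, h⟩ := ho' ε hε
  refine ⟨η, hη, fun v hv => ?_⟩
  have hfin : G.dist 0 v ≠ ⊤ := ne_top_of_le_ne_top ENNReal.ofReal_ne_top hv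
  have h2 := hle (-v) (by rwa [dist_zero_neg])
  rw [horInner_neg, hL.map_neg] at h2
  rw [le_antisymm (hle v hfin) (by linarith)]
  exact h v hv

/-- An upper bound for the distance from `exp (-sE)` to a point `w` with `d(w) ≤ η s`. -/
theorem dist_exp_neg_approx {E : 𝔤} (hE : E ∈ G.layer 1) {ε η : ℝ}
    (h : ∀ v, G.dist 0 v ≤ ENNReal.ofReal η →
      |G.distZero (G.mul (G.exp E) v) - 1 - G.horInner E v| ≤ ε * (G.dist 0 v).toReal)
    {s : ℝ} (hs : 0 < s) {w : Fin n → ℝ} (hw : G.dist 0 w ≠ ⊤)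
    (hsw : (G.dist 0 w).toReal ≤ s * η) :
    G.dist (G.exp ((-s) • E)) w ≠ ⊤ ∧ (G.dist (G.exp ((-s) • E)) w).toReal ≤
      s + G.horInner E w + ε * (G.dist 0 w).toReal := by
  set d := (G.dist 0 w).toReal with hd
  have hd0 : 0 ≤ d := ENNReal.toReal_nonneg
  set v := G.dilation s⁻¹ w with hv
  have hdv : G.dist 0 v = ENNReal.ofReal (s⁻¹ * d) := by
    rw [hv, dist_zero_dilation _ (inv_pos.2 hs), ENNReal.ofReal_mul (inv_pos.2 hs).le,
      ENNReal.ofReal_toReal hw]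
  have hsv : G.dilation s v = w := by
    rw [hv, dilation_dilation, mul_inv_cancel₀ hs.ne', dilation_one]
  -- Translate by `exp(sE)` and rescale by `1/s`: the distance becomes `s d(exp(E) v)` with `v` in
  -- the range of `h`.
  have e1 : G.dist (G.exp ((-s) • E)) w = ENNReal.ofReal s * G.dist 0 (G.mul (G.exp E) v) := by
    rw [← G.dist_zero_dilation hs, G.dilation_mul hs.ne', G.dilation_exp hE, hsv,
      ← G.dist_mul_left (G.exp (s • E)), mul_exp_smul_exp_smul, add_neg_cancel, zero_smul, exp_zero]
  have hfin := G.dist_mul_exp_ne_top hE (v := v) (by simp [hdv])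
  rw [e1]
  refine ⟨ENNReal.mul_ne_top ENNReal.ofReal_ne_top hfin, ?_⟩
  rw [ENNReal.toReal_mul, ENNReal.toReal_ofReal hs.le, ← distZero_eq]
  have h1 := h v (by
    rw [hdv]
    refine ENNReal.ofReal_le_ofReal ?_
    rw [inv_mul_le_iff₀ hs]
    exact hsw)
  rw [hdv, ENNReal.toReal_ofReal (by positivity), hv, horInner_dilation, ← hv] at h1
  have h2 := (abs_le.1 h1).2
  have h3 : G.distZero (G.mul (G.exp E) v) ≤ 1 + s⁻¹ * G.horInner E w + ε * (s⁻¹ * d) := by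
    linarith
  calc s * G.distZero (G.mul (G.exp E) v)
      ≤ s * (1 + s⁻¹ * G.horInner E w + ε * (s⁻¹ * d)) := by gcongr
    _ = s + G.horInner E w + ε * d := by field_simp

variable {G} in
theorem HasDirDeriv.exists_bound {f : (Fin n → ℝ) → ℝ} {x : Fin n → ℝ} {E : 𝔤} {v : ℝ}
    (h : G.HasDirDeriv f x E v) {ε : ℝ} (hε : 0 < ε) :
    ∃ ρ > 0, ∀ t : ℝ, |t| < ρ → |f (G.mul x (G.exp (t • E))) - f x - t * v| ≤ ε * |t| := by
  obtain ⟨ρ, hρ, H⟩ := Metric.tendsto_nhdsWithin_nhds.1 h ε hε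
  refine ⟨ρ, hρ, fun t ht => ?_⟩
  by_cases h0 : t = 0
  · simp [h0, exp_zero, mul_zero']
  have h1 := (H (x := t) h0 (by simpa using ht)).le
  rw [Real.dist_eq] at h1
  have e : f (G.mul x (G.exp (t • E))) - f x - t * v
      = ((f (G.mul x (G.exp (t • E))) - f x) / t - v) * t := by field_simp
  rw [e, abs_mul]
  gcongr

/-- Maximal growth along `E` makes the Lipschitz bounds from `x exp(sE)` and `x exp(-sE)` nearly
sharp, so they squeeze `f` near `x`. The differential is `ℓ⟨E, ·⟩`. -/
theorem pansuDifferentiableAt_of_hasDirDeriv_lip (hD : G.DistDifferentiableInHorizontalDirections)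
    {f : (Fin n → ℝ) → ℝ} (hf : G.IsLipschitz f) {x : Fin n → ℝ} {E : 𝔤} (hE : E ∈ G.layer 1)
    (h1 : G.omega E = 1) (hd : G.HasDirDeriv f x E (G.lip f)) : G.PansuDifferentiableAt f x := by
  set ℓ := G.lip f with hℓ
  have hℓ0 : 0 ≤ ℓ := G.lip_nonneg f
  refine ⟨fun v => ℓ * G.horInner E v, G.isGLinear_horInner ℓ E, ?_⟩
  rw [isLittleO_dist_iff]
  intro ε hε
  -- Chosen so that `ℓ ε₁ ≤ ε / 2`, also when `ℓ = 0`.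
  set ε₁ := ε / (2 * (ℓ + 1)) with hε₁
  have hε₁0 : 0 < ε₁ := by positivity
  have hE' : -E ∈ G.layer 1 := neg_mem hE
  obtain ⟨η₁, hη₁, H₁⟩ := G.distZero_mul_exp_approx hD hE h1 hε₁0
  obtain ⟨η₂, hη₂, H₂⟩ := G.distZero_mul_exp_approx hD hE' (by rw [omega_neg, h1]) hε₁0
  set η := min η₁ η₂ with hη
  have hη0 : 0 < η := lt_min hη₁ hη₂
  -- The error will be used at `s = t / η`, where `ε / 2 * η * s = ε / 2 * t`.
  obtain ⟨ρ, hρ, H⟩ := hd.exists_bound (ε := ε / 2 * η) (by positivity)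
  refine ⟨ρ * η / 2, by positivity, fun z hz => ?_⟩
  have hfin : G.dist x z ≠ ⊤ := ne_top_of_le_ne_top ENNReal.ofReal_ne_top hz
  set t := (G.dist x z).toReal with ht
  have ht0 : 0 ≤ t := ENNReal.toReal_nonneg
  have htle : t ≤ ρ * η / 2 := by
    have := ENNReal.toReal_mono ENNReal.ofReal_ne_top hz
    rwa [ENNReal.toReal_ofReal (by positivity)] at this
  set w := G.mul (-x) z with hw
  have hxw : G.mul x w = z := G.mul_neg_cancel_left' x z
  have hdw : G.dist 0 w = G.dist x z := by
    have := G.dist_mul_left x 0 w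
    rw [mul_zero', hxw] at this
    exact this.symm
  -- At distance zero the scale `s` would vanish. The claim then follows from the Lipschitz bounds,
  -- without knowing that `z = x`.
  rcases ht0.eq_or_lt with h0 | htpos
  · have hle1 := G.horInner_le_toReal_dist h1.le (y := w) (by rwa [hdw])
    have hle2 := G.horInner_le_toReal_dist h1.le (y := -w) (by rwa [dist_zero_neg, hdw])
    rw [hdw, ← ht, ← h0] at hle1
    rw [dist_zero_neg, hdw, ← ht, ← h0, horInner_neg] at hle2
    have hw0 : G.horInner E w = 0 := le_antisymm hle1 (by linarith)
    have hf0 := G.abs_sub_le_lip hf hfin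
    rw [← ht, ← h0, mul_zero, abs_nonpos_iff] at hf0
    have : f z - f x - ℓ * G.horInner E w = 0 := by rw [hw0]; linarith
    rw [this, ← h0]
    simp
  set s := t / η with hs
  have hs0 : 0 < s := by positivity
  have hsη : s * η = t := by rw [hs]; field_simp
  have hsρ : s < ρ := by
    rw [hs, div_lt_iff₀ hη0]
    have : 0 < ρ * η := by positivity
    linarith
  have hdist : ∀ y, G.dist (G.mul x y) z = G.dist y w := fun y => by
    rw [← hxw, dist_mul_left]
  obtain ⟨hA, hA'⟩ := G.dist_exp_neg_approx hE H₁ hs0 (w := w) (by rwa [hdw]) (by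
    rw [hdw, ← ht, ← hsη]
    exact mul_le_mul_of_nonneg_left (min_le_left _ _) hs0.le)
  obtain ⟨hB, hB'⟩ := G.dist_exp_neg_approx hE' H₂ hs0 (w := w) (by rwa [hdw]) (by
    rw [hdw, ← ht, ← hsη]
    exact mul_le_mul_of_nonneg_left (min_le_right _ _) hs0.le)
  rw [smul_neg, neg_smul, neg_neg] at hB hB'
  rw [hdw, ← ht] at hA' hB'
  rw [horInner_neg_left] at hB'
  have hfA := G.abs_sub_le_lip hf (x := G.mul x (G.exp ((-s) • E))) (y := z) (by rwa [hdist])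
  have hfB := G.abs_sub_le_lip hf (x := G.mul x (G.exp (s • E))) (y := z) (by rwa [hdist])
  rw [hdist, ← hℓ] at hfA hfB
  have hA'' := mul_le_mul_of_nonneg_left hA' hℓ0
  have hB'' := mul_le_mul_of_nonneg_left hB' hℓ0
  have hdA := H (-s) (by rwa [abs_neg, abs_of_pos hs0])
  have hdB := H s (by rwa [abs_of_pos hs0])
  rw [abs_neg, abs_of_pos hs0] at hdA
  rw [abs_of_pos hs0] at hdB
  have e1 : ε / 2 * η * s = ε / 2 * t := by rw [mul_assoc, mul_comm η, hsη]
  have e2 : ℓ * (ε₁ * t) ≤ ε / 2 * t := by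
    have : ℓ * ε₁ ≤ ε / 2 := by
      calc ℓ * ε₁ = ε / 2 * (ℓ / (ℓ + 1)) := by rw [hε₁]; field_simp
        _ ≤ ε / 2 := mul_le_of_le_one_right (by positivity)
          ((div_le_one (by positivity)).2 (by linarith))
    rw [← mul_assoc]
    gcongr
  rw [e1] at hdA hdB
  rw [abs_le] at hfA hfB hdA hdB ⊢
  -- The forward point `x exp(sE)` gives the lower bound, the backward point the upper one.
  constructor
  · linarith [hfB.2, hdB.1]
  · linarith [hfA.1, hdA.2]

/-- For `t > -ω(E)` the distance along the ray is exactly `ω(E) + t`, so the difference quotient is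
constant. -/
theorem hasDirDeriv_distZero_exp {E : 𝔤} (hE : E ∈ G.layer 1) (h0 : E ≠ 0) :
    G.HasDirDeriv G.distZero (G.exp E) ((G.omega E)⁻¹ • E) 1 := by
  have hc := G.omega_pos hE h0
  set c := G.omega E with hcdef
  refine tendsto_const_nhds.congr' ?_
  have hmem : Set.Ioi (-c) ∈ 𝓝 (0 : ℝ) := Ioi_mem_nhds (by linarith)
  filter_upwards [self_mem_nhdsWithin, nhdsWithin_le_nhds hmem] with t ht htc
  have htc' : -c < t := htc
  have e1 : G.mul (G.exp E) (G.exp (t • c⁻¹ • E)) = G.exp ((1 + t * c⁻¹) • E) := by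
    have := G.mul_exp_smul_exp_smul E 1 (t * c⁻¹)
    rwa [one_smul, mul_smul] at this
  have hpos : 0 ≤ 1 + t * c⁻¹ := by
    have : 1 + t * c⁻¹ = (c + t) / c := by field_simp
    rw [this]
    exact div_nonneg (by linarith) hc.le
  rw [e1, G.distZero_exp (Submodule.smul_mem _ _ hE), G.distZero_exp hE, omega_smul, ← hcdef,
    abs_of_nonneg hpos]
  have ht0 : t ≠ 0 := ht
  field_simp
  ring

end

end CarnotGroup

/-! ### The equivalence -/

theorem proposition1p3 {𝔤 : Type*} [LieRing 𝔤] [LieAlgebra ℝ 𝔤] {n : ℕ} (G : CarnotGroup 𝔤 n) :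
    G.DistDifferentiableInHorizontalDirections ↔
      ∀ f : (Fin n → ℝ) → ℝ, G.IsLipschitz f →
        ∀ x : Fin n → ℝ, ∀ E ∈ G.layer 1, G.omega E = 1 →
          G.HasDirDeriv f x E (G.lip f) → G.PansuDifferentiableAt f x := by
  constructor
  · intro hD f hf x E hE h1 hd
    exact G.pansuDifferentiableAt_of_hasDirDeriv_lip hD hf hE h1 hd
  · intro h E hE h0
    have hc := G.omega_pos hE h0
    have hE' : (G.omega E)⁻¹ • E ∈ G.layer 1 := Submodule.smul_mem _ _ hE
    have h1 : G.omega ((G.omega E)⁻¹ • E) = 1 := by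
      rw [G.omega_smul, abs_of_pos (inv_pos.2 hc), inv_mul_cancel₀ hc.ne']
    refine h G.distZero ⟨1, G.isLipschitzConstant_distZero⟩ (G.exp E) _ hE' h1 ?_
    rw [G.lip_distZero hE' h1]
    exact G.hasDirDeriv_distZero_exp hE h0
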